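/- Let $\Delta_3$ be a tetrahedron with vertex set $\{1,2,3,4\}$, let $E=\{S\subseteq\{1,2,3,4\}: |S|\ge 2\}$ be its set of $11$ positive-dimensional faces, and let $\varphi=(\varphi_S)_{S\in E}:\mathbb{C}^6\to\mathbb{C}^{E}$ be the polynomial map which sends $t=(t_{ij})_{1\le i<j\le 4}$ (squared edge lengths) to the squared volumes of all faces: for $|S|=k+1$, $$\varphi_S(t)=\frac{(-1)^{k+1}}{(k!)^2\,2^k}\,\det\begin{pmatrix}0&\mathbf 1^{T}\\ \mathbf 1&(t_{ij})_{i,j\in S}\end{pmatrix},\qquad t_{ii}=0,\ t_{ji}=t_{ij},$$ so that $\varphi_{\{i,j\}}=t_{ij}$. Let $X_3\subseteq\mathbb{C}^{E}$ be the Zariski closure of the image of $\varphi$ (the third Heron variety), and let $\mathcal M_3$ be its algebraic matroid: a subset $B\subseteq E$ is a basis of $\mathcal M_3$ if and only if the coordinate projection $\pi_B:X_3\to\mathbb{C}^{B}$ is dominant and generically finite-to-one. The affine mixed volume of a system $f_1,\dots,f_m\in\mathbb{C}[y_1,\dots,y_m]$ is the mixed volume of the polytopes $P_i=\operatorname{conv}(\{0\}\cup\operatorname{supp}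 f_i)\subset\mathbb{R}^m$, that is, $\sum_{I\subseteq\{1,\dots,m\}}(-1)^{m-|I|}\operatorname{vol}_m\bigl(\sum_{i\in I}P_i\bigr)$. **Proposition.** Let $B\subseteq E$ with $|B|=6$. For generic $b\in\mathbb{C}^B$ the following hold. 1. $B$ is not a basis of $\mathcal M_3$ if and only if the affine mixed volume of the system $$F_B=\{\varphi_S(t)-x_S\}_{S\in E\setminus B}\ \cup\ \{\varphi_S(t)-b_S\}_{S\in B}$$ of $11$ polynomials in the $11$ unknowns $t_{ij}$ ($1\le i<j\le4$) and $x_S$ ($S\in E\setminus B$) is zero. 2. Equally, $B$ is not a basis of $\mathcal M_3$ if and only if the affine mixed volume is zero for the system of $5$ polynomials in the $5$ unknowns $x_S$ ($S\in E\setminus B$) obtained from the defining equations $f_T=x_T-\varphi_T\bigl((x_{ij})_{i<j}\bigr)$, $T\in E$, $|T|\ge 3$, of $X_3$ by substituting $x_S=b_S$ for all $S\in B$. 3. Consequently the one-sided BKK test, which returns "false" if the affine mixed volume of $F_B$ is zero and "nothing" otherwise, characterizes the bases of $\mathcal M_3$: it returns "false" exactly when $B$ is not a basis, and "nothing" exactly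 when $B$ is a basis. -/

import Mathlib

namespace Heron

open scoped Pointwise

/-! ### Algebraic matroids of affine varieties -/

/-- The Zariski closure of a subset of affine space over `ℂ`. -/
def zariskiClosure {σ : Type*} (V : Set (σ → ℂ)) : Set (σ → ℂ) :=
  MvPolynomial.zeroLocus ℂ (MvPolynomial.vanishingIdeal ℂ V)

/-- `P b` holds for generic `b`: it holds off the zero set of some nonzero polynomial. -/
def ForGeneric {σ : Type*} (P : (σ → ℂ) → Prop) : Prop :=
  ∃ g : MvPolynomial σ ℂ, g ≠ 0 ∧ ∀ b : σ → ℂ, MvPolynomial.eval b g ≠ 0 → P b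

/-- The coordinate projection `π_B`. -/
def coordProj {ι : Type*} (B : Finset ι) (x : ι → ℂ) : B → ℂ :=
  fun i => x i

/-- `B` is a basis of the algebraic matroid of the variety `X`: the coordinate projection
`π_B : X → ℂ^B` is dominant and (as a map of varieties, that is, over generic points)
finite-to-one. -/
def IsAlgebraicBasis {ι : Type*} (X : Set (ι → ℂ)) (B : Finset ι) : Prop :=
  zariskiClosure (coordProj B '' X) = Set.univ ∧
    ForGeneric fun b : B → ℂ => {x ∈ X | coordProj B x = b}.Finite

/-! ### Heron varieties -/

/-- The positive-dimensional faces of the `n`-simplex with vertex set `Fin (n + 1)`. -/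
abbrev Face (n : ℕ) : Type := {S : Finset (Fin (n + 1)) // 1 < S.card}

/-- The edges of the `n`-simplex. -/
abbrev Edge (n : ℕ) : Type := {S : Finset (Fin (n + 1)) // S.card = 2}

/-- The positive-dimensional face underlying an edge. -/
def Edge.toFace {n : ℕ} (e : Edge n) : Face n :=
  ⟨e.1, by rw [e.2]; exact one_lt_two⟩

/-- The squared distance between two vertices, as a polynomial in the squared edge lengths. -/
noncomputable def sqDist {n : ℕ} (i j : Fin (n + 1)) : MvPolynomial (Edge n) ℂ :=
  if h : i = j then 0 else MvPolynomial.X ⟨{i, j}, Finset.card_pair h⟩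

/-- The Cayley-Menger matrix of the face `S`; the index `none` is the bordering row and column. -/
noncomputable def cayleyMenger {n : ℕ} (S : Finset (Fin (n + 1))) :
    Matrix (Option S) (Option S) (MvPolynomial (Edge n) ℂ) :=
  Matrix.of fun a b =>
    match a, b with
    | none, none => 0
    | none, some _ => 1
    | some _, none => 1
    | some i, some j => sqDist i.1 j.1

/-- The squared volume of the face `S`, as a polynomial in the squared edge lengths: if `S` has
`k + 1` vertices, it is `(-1) ^ (k + 1) / (k! ^ 2 * 2 ^ k)` times the Cayley-Menger determinant. -/
noncomputable def sqVol {n : ℕ} (S : Face n) : MvPolynomial (Edge n) ℂ :=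
  MvPolynomial.C ((-1 : ℂ) ^ S.1.card /
      (((S.1.card - 1).factorial : ℂ) ^ 2 * 2 ^ (S.1.card - 1))) *
    (cayleyMenger S.1).det

/-- The `n`-th Heron variety: the Zariski closure of the image of the map which sends squared edge
lengths to the squared volumes of all positive-dimensional faces. -/
noncomputable def heronVariety (n : ℕ) : Set (Face n → ℂ) :=
  zariskiClosure
    (Set.range fun (x : Edge n → ℂ) (S : Face n) => MvPolynomial.eval x (sqVol S))

/-! ### Affine mixed volumes -/

/-- The mixed volume of as many convex bodies in `ℝ^σ` as there are coordinates, normalized as in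
the BKK bound (it is the coefficient of `∏ i, t i` in the volume of `∑ i, t i • P i`), given by
the inclusion-exclusion formula over Minkowski sums. -/
noncomputable def mixedVolume {ι σ : Type*} [Fintype ι] [Fintype σ]
    (P : ι → Set (σ → ℝ)) : ℝ :=
  ∑ I ∈ (Finset.univ : Finset ι).powerset,
    (-1 : ℝ) ^ (Fintype.card ι - I.card) * (MeasureTheory.volume (∑ i ∈ I, P i)).toReal

/-- The convex hull of the origin and the exponent vectors of the monomials of `f`. -/
noncomputable def affineNewtonPolytope {σ : Type*} (f : MvPolynomial σ ℂ) : Set (σ → ℝ) :=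
  convexHull ℝ (insert 0 ((fun (m : σ →₀ ℕ) (i : σ) => (m i : ℝ)) '' (f.support : Set (σ →₀ ℕ))))

/-- The affine mixed volume of a square polynomial system, which bounds its number of isolated
zeros in affine space: the mixed volume of the Newton polytopes after the origin has been added
to every support. -/
noncomputable def affineMixedVolume {ι σ : Type*} [Fintype ι] [Fintype σ]
    (F : ι → MvPolynomial σ ℂ) : ℝ :=
  mixedVolume fun i => affineNewtonPolytope (F i)

/-! ### Polynomial systems describing a fibre of `π_B`, and the one-sided BKK test -/

/-- The square system `{φ_i - x_i}_{i ∉ B} ∪ {φ_i - b_i}_{i ∈ B}`, whose unknowns are the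
parameters of `φ` together with the `x_i` for `i ∉ B`. -/
noncomputable def fibreSystem {ι ρ : Type*} [DecidableEq ι] (φ : ι → MvPolynomial ρ ℂ)
    (B : Finset ι) (b : B → ℂ) : ι → MvPolynomial (ρ ⊕ {i : ι // i ∉ B}) ℂ :=
  fun i =>
    if h : i ∈ B then
      MvPolynomial.rename Sum.inl (φ i) - MvPolynomial.C (b ⟨i, h⟩)
    else
      MvPolynomial.rename Sum.inl (φ i) - MvPolynomial.X (Sum.inr ⟨i, h⟩)

/-- The one-sided BKK test: `some false` if the affine mixed volume is zero, and `none`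
("nothing") otherwise. -/
noncomputable def isBasisBKK {ι ρ : Type*} [Fintype ι] [DecidableEq ι] [Fintype ρ]
    (φ : ι → MvPolynomial ρ ℂ) (B : Finset ι) (b : B → ℂ) : Option Bool :=
  open Classical in
  if affineMixedVolume (fibreSystem φ B b) = 0 then some false else none

/-- The defining equation `f_T` of the Heron variety attached to a face `T` of dimension at
least two, which expresses the squared volume of `T` through the squared edge lengths. -/
noncomputable def heronEquation {n : ℕ} (T : {S : Face n // 2 < S.1.card}) :
    MvPolynomial (Face n) ℂ :=
  MvPolynomial.X T.1 - MvPolynomial.rename Edge.toFace (sqVol T.1)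

/-- The equations `f_T` of the Heron variety after the substitution `x_S = b_S` for `S ∈ B`: a
system in the remaining unknowns `x_S`, `S ∉ B`. It is square if `B` has as many elements as there
are edges. -/
noncomputable def implicitFibreSystem {n : ℕ} (B : Finset (Face n)) (b : B → ℂ) :
    {S : Face n // 2 < S.1.card} → MvPolynomial {S : Face n // S ∉ B} ℂ :=
  fun T => MvPolynomial.aeval
    (fun S : Face n => if h : S ∈ B then MvPolynomial.C (b ⟨S, h⟩) else MvPolynomial.X ⟨S, h⟩)
    (heronEquation T)

end Heron

namespace Heron

open Finset Matrix

/-! ### Mixed discriminants -/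

/-! Six faces of the tetrahedron fall under a dichotomy (`lt_facesWithin_or_linearIndependent`).
Either some edge set `W` contains all edges of more than `#W` faces of `B`, or the gradients of the
six squared volumes are linearly independent at the single point `tetPoint`. The possible
obstructions are a triangle together with its three edges, and an edge lying in no face of `B`.

In the first case more than `#W` of the volumes are polynomials in `#W` variables. So they are
algebraically dependent, and each of the two systems has too many equations in too few unknowns,
which makes its affine mixed volume zero for every `b`. In the second case the Jacobian criterion
gives algebraic independence. Both systems then have a nonzero Jacobian determinant, which forces a
nonzero affine mixed volume; only the implicit system needs `b` generic.

The geometric link is that the Heron variety is the graph of `φ` over the edge coordinates, so for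
six faces being a basis means algebraic independence of their volumes
(`isAlgebraicBasis_heronVariety_iff`). The convex link is `affineMixedVolume_ne_zero_iff`: the
affine mixed volume is nonzero exactly when one monomial can be picked from each polynomial with
linearly independent exponent vectors. For its proof, the volume of a Minkowski sum is the integral
of the determinant of a sum of covariance matrices, by change of variables along moment maps.
Inclusion-exclusion turns these determinants into a mixed discriminant, a sum of positive weights
times squared determinants, so the mixed volume is the integral of a continuous nonnegative density.
-/

theorem sum_powerset_neg_one_pow_mul_ite_forall_mem {n ι : Type*} [Fintype n] [Fintype ι]
    [DecidableEq ι] (f : n → ι) :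
    ∑ I ∈ (univ : Finset ι).powerset,
      (-1 : ℝ) ^ (Fintype.card ι - #I) * (if ∀ k, f k ∈ I then 1 else 0) =
      if Function.Surjective f then 1 else 0 := by
  classical
  -- Expanding `∏ i, (1 + g i)` over subsets `I`, with `g` equal to `0` on the range of `f` and `-1`
  -- off it, keeps only those `I` that contain the range. The product itself has a factor `1 - 1`
  -- unless `f` is surjective.
  have key := Finset.prod_add (fun _ : ι => (1 : ℝ))
    (fun i => if ∃ k, f k = i then 0 else -1) univ
  have h1 : ∏ i : ι, ((1 : ℝ) + if ∃ k, f k = i then 0 else -1) =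
      if Function.Surjective f then 1 else 0 := by
    split_ifs with h
    · refine prod_eq_one fun i _ => ?_
      rw [if_pos (h i), add_zero]
    · simp only [Function.Surjective, not_forall] at h
      obtain ⟨i, hi⟩ := h
      refine prod_eq_zero (mem_univ i) ?_
      rw [if_neg hi]; norm_num
  rw [← h1, key]
  refine sum_congr rfl fun I _ => ?_
  rw [prod_const_one, one_mul]
  split_ifs with h
  · rw [mul_one, ← card_univ, ← card_sdiff_of_subset (subset_univ I), ← prod_const]
    refine prod_congr rfl fun i hi => ?_
    rw [if_neg]
    rintro ⟨k, rfl⟩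
    exact (mem_sdiff.1 hi).2 (h k)
  · push Not at h
    obtain ⟨k, hk⟩ := h
    rw [mul_zero]
    symm
    refine prod_eq_zero (i := f k) (by simp [hk]) ?_
    rw [if_pos ⟨k, rfl⟩]

theorem det_sum_eq_sum_det_rows {n ι : Type*} [Fintype n] [DecidableEq n] [DecidableEq ι]
    (M : ι → Matrix n n ℝ) (I : Finset ι) :
    (∑ i ∈ I, M i).det =
      ∑ f ∈ Fintype.piFinset fun _ : n => I, (Matrix.of fun k => M (f k) k).det := by
  have h := (detRowAlternating (n := n) (R := ℝ)).toMultilinearMap.map_sum_finset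
    (fun (k : n) (i : ι) => M i k) (fun _ => I)
  refine Eq.trans ?_ h
  change Matrix.det _ = Matrix.det _
  congr 1
  ext k j
  simp [Matrix.sum_apply, Finset.sum_apply]

/-- The mixed discriminant, by polarization of the determinant. -/
theorem sum_powerset_det_sum {n : Type*} [Fintype n] [DecidableEq n] (M : n → Matrix n n ℝ) :
    ∑ I ∈ (univ : Finset n).powerset,
      (-1 : ℝ) ^ (Fintype.card n - #I) * (∑ i ∈ I, M i).det =
      ∑ σ : Equiv.Perm n, (Matrix.of fun k => M (σ k) k).det := by
  classical
  have h1 : ∀ I : Finset n, (∑ i ∈ I, M i).det =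
      ∑ f : n → n, (if ∀ k, f k ∈ I then 1 else 0) * (Matrix.of fun k => M (f k) k).det := by
    intro I
    rw [det_sum_eq_sum_det_rows]
    simp only [ite_mul, one_mul, zero_mul]
    rw [← sum_filter]
    refine sum_congr ?_ fun _ _ => rfl
    ext f
    simp [Fintype.mem_piFinset]
  simp only [h1, mul_sum]
  rw [sum_comm]
  simp only [← mul_assoc, ← sum_mul, sum_powerset_neg_one_pow_mul_ite_forall_mem]
  simp only [ite_mul, one_mul, zero_mul]
  rw [← sum_filter]
  refine (sum_bij (fun (σ : Equiv.Perm n) _ => (σ : n → n)) ?_ ?_ ?_ ?_).symm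
  · intro σ _
    simpa using σ.surjective
  · intro σ _ τ _ h
    exact DFunLike.coe_injective h
  · intro f hf
    have hs : Function.Surjective f := by simpa using hf
    exact ⟨Equiv.ofBijective f (Finite.surjective_iff_bijective.1 hs), mem_univ _, rfl⟩
  · intro σ _
    rfl

/-- The mixed discriminant of nonnegative combinations of rank one matrices. -/
theorem sum_powerset_det_sum_vecMulVec {n α : Type*} [Fintype n] [DecidableEq n] [DecidableEq α]
    (A : n → Finset α) (p : n → α → ℝ) (z : n → α → n → ℝ) :
    ∑ I ∈ (univ : Finset n).powerset, (-1 : ℝ) ^ (Fintype.card n - #I) *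
        (∑ i ∈ I, ∑ a ∈ A i, p i a • vecMulVec (z i a) (z i a)).det =
      ∑ r ∈ Fintype.piFinset A,
        (∏ i, p i (r i)) * (Matrix.of fun i => z i (r i)).det ^ 2 := by
  rw [sum_powerset_det_sum]
  set M : n → Matrix n n ℝ := fun i => ∑ a ∈ A i, p i a • vecMulVec (z i a) (z i a) with hM
  have h1 : ∀ σ : Equiv.Perm n, (Matrix.of fun k => M (σ k) k).det =
      (Equiv.Perm.sign σ : ℝ) * (Matrix.of fun i => M i (σ⁻¹ i)).det := by
    intro σ
    have := det_permute σ (Matrix.of fun i => M i (σ⁻¹ i))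
    rw [← this]
    congr 1
    ext k j
    simp
  -- Each row of `vecMulVec z z` is a multiple of `z`, so the expansion by rows yields the same
  -- determinant for every `σ`. The signed sum over `σ` of the scalar factors supplies a second copy
  -- of it, hence the square.
  have h2 : ∀ σ : Equiv.Perm n, (Matrix.of fun i => M i (σ i)).det =
      ∑ r ∈ Fintype.piFinset A, (∏ i, p i (r i)) * (∏ i, z i (r i) (σ i)) *
        (Matrix.of fun i => z i (r i)).det := by
    intro σ
    have h := (detRowAlternating (n := n) (R := ℝ)).toMultilinearMap.map_sum_finset
      (fun (i : n) (a : α) => (p i a * z i a (σ i)) • z i a) A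
    have e : (fun i => ∑ a ∈ A i, (p i a * z i a (σ i)) • z i a) =
        (Matrix.of fun i => M i (σ i)) := by
      ext i j
      simp [hM, Matrix.sum_apply, Finset.sum_apply, vecMulVec_apply, mul_assoc]
    rw [e] at h
    refine h.trans (sum_congr rfl fun r _ => ?_)
    rw [← prod_mul_distrib]
    exact (detRowAlternating (n := n) (R := ℝ)).toMultilinearMap.map_smul_univ _ _
  calc ∑ σ : Equiv.Perm n, (Matrix.of fun k => M (σ k) k).det
      = ∑ σ : Equiv.Perm n, (Equiv.Perm.sign σ : ℝ) * (Matrix.of fun i => M i (σ i)).det := by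
        rw [← Equiv.sum_comp (Equiv.inv (Equiv.Perm n))]
        refine sum_congr rfl fun σ _ => ?_
        rw [h1]
        simp
    _ = _ := by
        simp only [h2, mul_sum]
        rw [sum_comm]
        refine sum_congr rfl fun r _ => ?_
        rw [sq, ← mul_assoc]
        have h3 : (Matrix.of fun i => z i (r i)).det =
            ∑ σ : Equiv.Perm n, (Equiv.Perm.sign σ : ℝ) * ∏ i, z i (r i) (σ i) := by
          rw [← det_transpose, det_apply']
          rfl
        nth_rewrite 2 [h3]
        rw [mul_sum, sum_mul]
        refine sum_congr rfl fun σ _ => ?_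
        ring

open Finset Matrix MeasureTheory Filter
open scoped Pointwise

/-! ### The moment map of a finite set of exponents -/

section MomentMap

variable {σ : Type*} [Fintype σ]

/-- The exponential sum with exponents `A`. -/
noncomputable def expSum (A : Finset (σ → ℝ)) (θ : σ → ℝ) : ℝ :=
  ∑ a ∈ A, Real.exp (a ⬝ᵥ θ)

/-- The Gibbs weight of `a` in the exponential sum with exponents `A`. -/
noncomputable def gibbsWeight (A : Finset (σ → ℝ)) (θ a : σ → ℝ) : ℝ :=
  Real.exp (a ⬝ᵥ θ - Real.log (expSum A θ))

/-- The moment map: the mean of the Gibbs weights. -/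
noncomputable def momentMap (A : Finset (σ → ℝ)) (θ : σ → ℝ) : σ → ℝ :=
  ∑ a ∈ A, gibbsWeight A θ a • a

/-- The covariance matrix of the Gibbs weights. -/
noncomputable def gibbsCov (A : Finset (σ → ℝ)) (θ : σ → ℝ) : Matrix σ σ ℝ :=
  ∑ a ∈ A, gibbsWeight A θ a • vecMulVec (a - momentMap A θ) (a - momentMap A θ)

/-- The continuous linear functional `v ↦ a ⬝ᵥ v`. -/
noncomputable def dotCLM (a : σ → ℝ) : (σ → ℝ) →L[ℝ] ℝ :=
  LinearMap.toContinuousLinearMap (dotProductBilin ℝ ℝ a)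

@[simp]
theorem dotCLM_apply (a v : σ → ℝ) : dotCLM a v = a ⬝ᵥ v := rfl

theorem hasFDerivAt_dotProduct (a θ : σ → ℝ) :
    HasFDerivAt (fun θ : σ → ℝ => a ⬝ᵥ θ) (dotCLM a) θ :=
  (dotCLM a).hasFDerivAt

variable {A : Finset (σ → ℝ)}

theorem expSum_pos (hA : A.Nonempty) (θ : σ → ℝ) : 0 < expSum A θ :=
  sum_pos (fun _ _ => Real.exp_pos _) hA

theorem gibbsWeight_pos (A : Finset (σ → ℝ)) (θ a : σ → ℝ) : 0 < gibbsWeight A θ a :=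
  Real.exp_pos _

theorem gibbsWeight_eq_div (hA : A.Nonempty) (θ a : σ → ℝ) :
    gibbsWeight A θ a = Real.exp (a ⬝ᵥ θ) / expSum A θ := by
  rw [gibbsWeight, Real.exp_sub, Real.exp_log (expSum_pos hA θ)]

theorem sum_gibbsWeight (hA : A.Nonempty) (θ : σ → ℝ) : ∑ a ∈ A, gibbsWeight A θ a = 1 := by
  simp only [gibbsWeight_eq_div hA]
  rw [← sum_div]
  exact div_self (expSum_pos hA θ).ne'

theorem momentMap_dotProduct (A : Finset (σ → ℝ)) (θ u : σ → ℝ) :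
    momentMap A θ ⬝ᵥ u = ∑ a ∈ A, gibbsWeight A θ a * (a ⬝ᵥ u) := by
  simp [momentMap, sum_dotProduct, smul_dotProduct]

theorem hasFDerivAt_log_expSum (hA : A.Nonempty) (θ : σ → ℝ) :
    HasFDerivAt (fun θ => Real.log (expSum A θ)) (dotCLM (momentMap A θ)) θ := by
  have h : HasFDerivAt (expSum A) (∑ a ∈ A, Real.exp (a ⬝ᵥ θ) • dotCLM a) θ := by
    have := HasFDerivAt.fun_sum (u := A) (x := θ)
      fun a _ => (hasFDerivAt_dotProduct a θ).exp
    exact this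
  refine (h.log (expSum_pos hA θ).ne').congr_fderiv ?_
  ext1 v
  simp only [dotCLM_apply, momentMap_dotProduct, gibbsWeight_eq_div hA,
    _root_.smul_apply, _root_.sum_apply, smul_eq_mul, mul_sum]
  refine sum_congr rfl fun a _ => ?_
  ring

theorem hasFDerivAt_gibbsWeight (hA : A.Nonempty) (θ a : σ → ℝ) :
    HasFDerivAt (fun θ => gibbsWeight A θ a)
      (gibbsWeight A θ a • dotCLM (a - momentMap A θ)) θ := by
  refine ((hasFDerivAt_dotProduct a θ).sub (hasFDerivAt_log_expSum hA θ)).exp.congr_fderiv ?_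
  ext1 v
  simp [gibbsWeight, sub_dotProduct]

theorem hasFDerivAt_momentMap [DecidableEq σ] (hA : A.Nonempty) (θ : σ → ℝ) :
    HasFDerivAt (momentMap A) (LinearMap.toContinuousLinearMap (toLin' (gibbsCov A θ))) θ := by
  have h := HasFDerivAt.fun_sum (u := A) (x := θ)
    fun a _ => (hasFDerivAt_gibbsWeight hA θ a).smul_const a
  refine (h.congr_fderiv ?_ : HasFDerivAt (fun θ => ∑ a ∈ A, gibbsWeight A θ a • a) _ θ)
  ext1 v
  set m := momentMap A θ with hm
  -- The weighted deviations from the mean cancel, so the rank one terms may be centred in both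
  -- factors.
  have h0 : ∑ a ∈ A, gibbsWeight A θ a * ((a - m) ⬝ᵥ v) = 0 := by
    simp only [sub_dotProduct, mul_sub, sum_sub_distrib, ← sum_mul, sum_gibbsWeight hA]
    rw [← momentMap_dotProduct, one_mul, sub_self]
  have h1 : ∀ a : σ → ℝ, vecMulVec (a - m) (a - m) *ᵥ v = ((a - m) ⬝ᵥ v) • (a - m) := by
    intro a
    rw [vecMulVec_mulVec]
    ext j
    simp [mul_comm]
  simp only [_root_.sum_apply, ContinuousLinearMap.smulRight_apply,
    _root_.smul_apply, dotCLM_apply, smul_eq_mul,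
    LinearMap.coe_toContinuousLinearMap', toLin'_apply, gibbsCov, sum_mulVec, smul_mulVec, ← hm,
    h1, smul_smul, smul_sub, sum_sub_distrib, ← sum_smul, h0, zero_smul, sub_zero]

theorem continuous_momentMap (hA : A.Nonempty) : Continuous (momentMap A) := by
  classical
  exact continuous_iff_continuousAt.2 fun θ => (hasFDerivAt_momentMap hA θ).continuousAt

theorem continuous_gibbsWeight (hA : A.Nonempty) (a : σ → ℝ) :
    Continuous fun θ => gibbsWeight A θ a :=
  continuous_iff_continuousAt.2 fun θ => (hasFDerivAt_gibbsWeight hA θ a).continuousAt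

theorem continuous_gibbsCov (hA : A.Nonempty) : Continuous (gibbsCov A) := by
  have h1 := continuous_momentMap hA
  refine continuous_finsetSum _ fun _ _ => (continuous_gibbsWeight hA _).smul ?_
  exact Continuous.matrix_vecMulVec (by fun_prop) (by fun_prop)

theorem posSemidef_gibbsCov (A : Finset (σ → ℝ)) (θ : σ → ℝ) : (gibbsCov A θ).PosSemidef := by
  refine posSemidef_sum _ fun a _ => PosSemidef.smul ?_ (gibbsWeight_pos A θ a).le
  simpa using posSemidef_vecMulVec_self_star (a - momentMap A θ)

theorem momentMap_mem_convexHull (hA : A.Nonempty) (θ : σ → ℝ) :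
    momentMap A θ ∈ convexHull ℝ (A : Set (σ → ℝ)) :=
  (convex_convexHull ℝ _).sum_mem (fun a _ => (gibbsWeight_pos A θ a).le)
    (sum_gibbsWeight hA θ) fun a ha => subset_convexHull ℝ _ ha

/-- The left side is linear in `p`, so only `p ∈ A` matters, where the exponential is one of the
summands. This bound on the support function later gives coercivity. -/
theorem dotProduct_le_log_expSum {p : σ → ℝ} (hp : p ∈ convexHull ℝ (A : Set (σ → ℝ)))
    (θ : σ → ℝ) : p ⬝ᵥ θ ≤ Real.log (expSum A θ) := by
  have hc : Convex ℝ {p : σ → ℝ | p ⬝ᵥ θ ≤ Real.log (expSum A θ)} := by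
    have := convex_halfSpace_le (𝕜 := ℝ) (f := fun p : σ → ℝ => p ⬝ᵥ θ)
      ⟨fun x y => add_dotProduct x y θ, fun c x => smul_dotProduct c x θ⟩
      (Real.log (expSum A θ))
    exact this
  refine convexHull_min (fun a ha => ?_) hc hp
  have ha' : a ∈ A := ha
  rw [Set.mem_ofPred_eq, Real.le_log_iff_exp_le (expSum_pos ⟨a, ha'⟩ θ)]
  exact single_le_sum (f := fun a => Real.exp (a ⬝ᵥ θ)) (fun _ _ => (Real.exp_pos _).le) ha'

/-- Together with `sum_gibbsWeight_mul_add_one` this reduces the convexity of `log ∘ expSum` to `x +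
1 ≤ exp x`, term by term. -/
theorem sum_gibbsWeight_mul_exp (hA : A.Nonempty) (θ u : σ → ℝ) :
    ∑ a ∈ A, gibbsWeight A θ a * Real.exp (a ⬝ᵥ u - momentMap A θ ⬝ᵥ u) =
      Real.exp (Real.log (expSum A (θ + u)) - Real.log (expSum A θ) - momentMap A θ ⬝ᵥ u) := by
  rw [Real.exp_sub, Real.exp_sub, Real.exp_log (expSum_pos hA _), expSum, sum_div, sum_div]
  refine sum_congr rfl fun a _ => ?_
  rw [gibbsWeight, ← Real.exp_add, ← Real.exp_sub, dotProduct_add,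
    ← Real.exp_sub]
  congr 1
  ring

theorem sum_gibbsWeight_mul_add_one (hA : A.Nonempty) (θ u : σ → ℝ) :
    ∑ a ∈ A, gibbsWeight A θ a * ((a ⬝ᵥ u - momentMap A θ ⬝ᵥ u) + 1) = 1 := by
  simp only [mul_add, mul_sub, sum_add_distrib, sum_sub_distrib, ← sum_mul, mul_one,
    sum_gibbsWeight hA, ← momentMap_dotProduct]
  ring

theorem momentMap_dotProduct_le (hA : A.Nonempty) (θ u : σ → ℝ) :
    momentMap A θ ⬝ᵥ u ≤ Real.log (expSum A (θ + u)) - Real.log (expSum A θ) := by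
  have h : (1 : ℝ) ≤ Real.exp
      (Real.log (expSum A (θ + u)) - Real.log (expSum A θ) - momentMap A θ ⬝ᵥ u) := by
    rw [← sum_gibbsWeight_mul_exp hA, ← sum_gibbsWeight_mul_add_one hA θ u]
    exact sum_le_sum fun a _ =>
      mul_le_mul_of_nonneg_left (Real.add_one_le_exp _) (gibbsWeight_pos A θ a).le
  linarith [Real.one_le_exp_iff.1 h]

/-- Since `0 ∈ A` and some `a ⬝ᵥ u` is nonzero, `a ⬝ᵥ u` is not constant on `A`, so some term
differs from the mean and is strict. -/
theorem momentMap_dotProduct_lt (h0 : 0 ∈ A) (θ u : σ → ℝ) (hu : ∃ a ∈ A, a ⬝ᵥ u ≠ 0) :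
    momentMap A θ ⬝ᵥ u < Real.log (expSum A (θ + u)) - Real.log (expSum A θ) := by
  have hA : A.Nonempty := ⟨0, h0⟩
  have hex : ∃ a ∈ A, a ⬝ᵥ u - momentMap A θ ⬝ᵥ u ≠ 0 := by
    by_contra! h
    obtain ⟨a, ha, hau⟩ := hu
    have h1 := h 0 h0
    have h2 := h a ha
    rw [zero_dotProduct] at h1
    exact hau (by linarith)
  have h : (1 : ℝ) < Real.exp
      (Real.log (expSum A (θ + u)) - Real.log (expSum A θ) - momentMap A θ ⬝ᵥ u) := by
    rw [← sum_gibbsWeight_mul_exp hA, ← sum_gibbsWeight_mul_add_one hA θ u]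
    obtain ⟨a, ha, hau⟩ := hex
    exact sum_lt_sum (fun a _ =>
      mul_le_mul_of_nonneg_left (Real.add_one_le_exp _) (gibbsWeight_pos A θ a).le)
      ⟨a, ha, mul_lt_mul_of_pos_left (Real.add_one_lt_exp hau) (gibbsWeight_pos A θ a)⟩
  linarith [Real.one_lt_exp_iff.1 h]

/-! ### Volumes of Minkowski sums -/

variable {ι : Type*} {A : ι → Finset (σ → ℝ)}

/-- The map is the gradient of a strictly convex function: the tangent inequalities at `θ` and `θ'`
add up to a contradiction if the gradients agree. -/
theorem injective_sum_momentMap (h0 : ∀ i, 0 ∈ A i) (I : Finset ι)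
    (hI : ∀ u : σ → ℝ, (∀ i ∈ I, ∀ a ∈ A i, a ⬝ᵥ u = 0) → u = 0) :
    Function.Injective fun θ => ∑ i ∈ I, momentMap (A i) θ := by
  intro θ θ' h
  by_contra hne
  have hex : ∃ i ∈ I, ∃ a ∈ A i, a ⬝ᵥ (θ' - θ) ≠ 0 := by
    by_contra! hall
    exact hne (sub_eq_zero.1 (hI _ hall)).symm
  obtain ⟨i, hi, hia⟩ := hex
  have e1 : ∑ i ∈ I, momentMap (A i) θ ⬝ᵥ (θ' - θ) <
      ∑ i ∈ I, (Real.log (expSum (A i) θ') - Real.log (expSum (A i) θ)) := by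
    refine sum_lt_sum (fun j _ => ?_) ⟨i, hi, ?_⟩
    · simpa using momentMap_dotProduct_le ⟨0, h0 j⟩ θ (θ' - θ)
    · simpa using momentMap_dotProduct_lt (h0 i) θ (θ' - θ) hia
  have e2 : ∑ i ∈ I, momentMap (A i) θ' ⬝ᵥ (θ - θ') ≤
      ∑ i ∈ I, (Real.log (expSum (A i) θ) - Real.log (expSum (A i) θ')) := by
    refine sum_le_sum fun j _ => ?_
    simpa using momentMap_dotProduct_le ⟨0, h0 j⟩ θ' (θ - θ')
  rw [← sum_dotProduct, sum_sub_distrib] at e1 e2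
  have h' : ∑ i ∈ I, momentMap (A i) θ = ∑ i ∈ I, momentMap (A i) θ' := h
  rw [← h', ← neg_sub, dotProduct_neg] at e2
  linarith

theorem sum_momentMap_mem (h0 : ∀ i, 0 ∈ A i) (I : Finset ι) (θ : σ → ℝ) :
    ∑ i ∈ I, momentMap (A i) θ ∈ ∑ i ∈ I, convexHull ℝ (A i : Set (σ → ℝ)) :=
  Set.finsetSum_mem_finsetSum _ _ _ fun i _ => momentMap_mem_convexHull ⟨0, h0 i⟩ θ

theorem dotProduct_le_sum_log_expSum (I : Finset ι) {p : σ → ℝ}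
    (hp : p ∈ ∑ i ∈ I, convexHull ℝ (A i : Set (σ → ℝ))) (θ : σ → ℝ) :
    p ⬝ᵥ θ ≤ ∑ i ∈ I, Real.log (expSum (A i) θ) := by
  obtain ⟨g, hg, rfl⟩ := (Set.mem_finsetSum _ _ _).1 hp
  rw [sum_dotProduct]
  exact sum_le_sum fun i hi => dotProduct_le_log_expSum (hg hi) θ

/-- A preimage of `y` is a critical point of `f`, the sum of the log exponential sums minus `y ⬝ᵥ
θ`; a minimum exists because `f` is coercive when `y` is interior. -/
theorem interior_subset_range_sum_momentMap (h0 : ∀ i, 0 ∈ A i) (I : Finset ι) :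
    interior (∑ i ∈ I, convexHull ℝ (A i : Set (σ → ℝ))) ⊆
      Set.range fun θ => ∑ i ∈ I, momentMap (A i) θ := by
  intro y hy
  obtain ⟨r, hr, hball⟩ := Metric.nhds_basis_closedBall.mem_iff.1 (mem_interior_iff_mem_nhds.1 hy)
  set f : (σ → ℝ) → ℝ := fun θ => ∑ i ∈ I, Real.log (expSum (A i) θ) - y ⬝ᵥ θ with hf
  have hd : ∀ θ, HasFDerivAt f (∑ i ∈ I, dotCLM (momentMap (A i) θ) - dotCLM y) θ := fun θ =>
    (HasFDerivAt.fun_sum fun i _ => hasFDerivAt_log_expSum ⟨0, h0 i⟩ θ).sub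
      (hasFDerivAt_dotProduct y θ)
  have hcoer : ∀ θ, r * ‖θ‖ ≤ f θ := by
    intro θ
    -- This point of the sup-norm ball around `y` pairs with `θ` to `y ⬝ᵥ θ` plus `r` times the `ℓ¹`
    -- norm of `θ`.
    have hmem : y + r • (fun j => (SignType.sign (θ j) : ℝ)) ∈
        ∑ i ∈ I, convexHull ℝ (A i : Set (σ → ℝ)) := by
      apply hball
      rw [Metric.mem_closedBall, dist_self_add_left, norm_smul, Real.norm_of_nonneg hr.le]
      refine mul_le_of_le_one_right hr.le ((pi_norm_le_iff_of_nonneg zero_le_one).2 fun j => ?_)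
      rcases lt_trichotomy (θ j) 0 with h | h | h <;> simp [h]
    have h1 := dotProduct_le_sum_log_expSum I hmem θ
    rw [add_dotProduct, smul_dotProduct, smul_eq_mul] at h1
    have h2 : ‖θ‖ ≤ (fun j => (SignType.sign (θ j) : ℝ)) ⬝ᵥ θ := by
      have h3 : ∀ j, (SignType.sign (θ j) : ℝ) * θ j = |θ j| := fun j => by
        simp
      simp only [dotProduct, h3]
      refine (pi_norm_le_iff_of_nonneg (sum_nonneg fun _ _ => abs_nonneg _)).2 fun j => ?_
      exact single_le_sum (f := fun j => |θ j|) (fun _ _ => abs_nonneg _) (mem_univ j)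
    have h4 := mul_le_mul_of_nonneg_left h2 hr.le
    simp only [hf]
    linarith
  have hcont : Continuous f := continuous_iff_continuousAt.2 fun θ => (hd θ).continuousAt
  have htend : Tendsto f (cocompact (σ → ℝ)) atTop :=
    tendsto_atTop_mono hcoer ((tendsto_norm_cocompact_atTop (E := σ → ℝ)).const_mul_atTop hr)
  obtain ⟨θ, hθ⟩ := hcont.exists_forall_le htend
  have hz := (show IsLocalMin f θ from Eventually.of_forall hθ).hasFDerivAt_eq_zero (hd θ)
  refine ⟨θ, ?_⟩
  classical
  ext j
  have := congrArg (fun L : (σ → ℝ) →L[ℝ] ℝ => L (Pi.single j 1)) hz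
  simp only [_root_.sub_apply, _root_.sum_apply, dotCLM_apply,
    _root_.zero_apply, dotProduct_single, mul_one] at this
  simp only [Finset.sum_apply]
  linarith

theorem convex_sum_convexHull (I : Finset ι) :
    Convex ℝ (∑ i ∈ I, convexHull ℝ (A i : Set (σ → ℝ))) := by
  rw [← convexHull_sum]
  exact convex_convexHull ℝ _

theorem isCompact_sum_convexHull (I : Finset ι) :
    IsCompact (∑ i ∈ I, convexHull ℝ (A i : Set (σ → ℝ))) := by
  classical
  induction I using Finset.induction with
  | empty => simp
  | insert i I hi ih =>
    rw [sum_insert hi]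
    exact ((A i).finite_toSet.isCompact_convexHull ℝ).add ih

theorem posSemidef_sum_gibbsCov (I : Finset ι) (θ : σ → ℝ) :
    (∑ i ∈ I, gibbsCov (A i) θ).PosSemidef :=
  posSemidef_sum _ fun i _ => posSemidef_gibbsCov (A i) θ

/-- If the exponents span, the sum of moment maps is injective, and its image lies between the
interior and the whole of the convex body, whose boundary is null. Otherwise a vector orthogonal to
all exponents makes both sides zero. -/
theorem volume_sum_convexHull [DecidableEq σ] (h0 : ∀ i, 0 ∈ A i) (I : Finset ι) :
    volume (∑ i ∈ I, convexHull ℝ (A i : Set (σ → ℝ))) =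
      ∫⁻ θ, ENNReal.ofReal (∑ i ∈ I, gibbsCov (A i) θ).det := by
  by_cases hI : ∀ u : σ → ℝ, (∀ i ∈ I, ∀ a ∈ A i, a ⬝ᵥ u = 0) → u = 0
  · have hinj := injective_sum_momentMap h0 I hI
    have hder : ∀ θ, HasFDerivAt (fun θ => ∑ i ∈ I, momentMap (A i) θ)
        (∑ i ∈ I, LinearMap.toContinuousLinearMap (toLin' (gibbsCov (A i) θ))) θ := fun θ =>
      HasFDerivAt.fun_sum fun i _ => hasFDerivAt_momentMap ⟨0, h0 i⟩ θ
    have hdet : ∀ θ, (∑ i ∈ I,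
        LinearMap.toContinuousLinearMap (toLin' (gibbsCov (A i) θ))).det =
        (∑ i ∈ I, gibbsCov (A i) θ).det := by
      intro θ
      rw [← map_sum, ← map_sum, LinearMap.det_toContinuousLinearMap, LinearMap.det_toLin']
    have key := lintegral_abs_det_fderiv_eq_addHaar_image volume MeasurableSet.univ
      (fun θ _ => (hder θ).hasFDerivWithinAt) hinj.injOn
    rw [Set.image_univ, Measure.restrict_univ] at key
    simp only [hdet, abs_of_nonneg (posSemidef_sum_gibbsCov I _).det_nonneg] at key
    rw [key]
    refine le_antisymm ?_ (measure_mono ?_)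
    · calc volume (∑ i ∈ I, convexHull ℝ (A i : Set (σ → ℝ)))
          ≤ volume (interior (∑ i ∈ I, convexHull ℝ (A i : Set (σ → ℝ))) ∪
              frontier (∑ i ∈ I, convexHull ℝ (A i : Set (σ → ℝ)))) := by
            refine measure_mono ?_
            rw [← closure_eq_interior_union_frontier]
            exact subset_closure
        _ ≤ volume (interior (∑ i ∈ I, convexHull ℝ (A i : Set (σ → ℝ)))) + 0 := by
            refine (measure_union_le _ _).trans ?_
            rw [(convex_sum_convexHull I).addHaar_frontier volume]
        _ ≤ _ := by
            rw [add_zero]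
            exact measure_mono (interior_subset_range_sum_momentMap h0 I)
    · rintro _ ⟨θ, rfl⟩
      exact sum_momentMap_mem h0 I θ
  · push Not at hI
    obtain ⟨u, hu, hu0⟩ := hI
    have hdet : ∀ θ, (∑ i ∈ I, gibbsCov (A i) θ).det = 0 := by
      intro θ
      refine exists_mulVec_eq_zero_iff.1 ⟨u, hu0, ?_⟩
      rw [sum_mulVec]
      refine sum_eq_zero fun i hi => ?_
      have hm : momentMap (A i) θ ⬝ᵥ u = 0 := by
        rw [momentMap_dotProduct]
        exact sum_eq_zero fun a ha => by rw [hu i hi a ha, mul_zero]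
      rw [gibbsCov, sum_mulVec]
      refine sum_eq_zero fun a ha => ?_
      rw [smul_mulVec, vecMulVec_mulVec, sub_dotProduct, hm, hu i hi a ha]
      simp
    simp only [hdet, ENNReal.ofReal_zero, lintegral_zero]
    have hker : LinearMap.ker (dotProductBilin ℝ ℝ u : (σ → ℝ) →ₗ[ℝ] ℝ) ≠ ⊤ := by
      intro h
      have : u ∈ LinearMap.ker (dotProductBilin ℝ ℝ u : (σ → ℝ) →ₗ[ℝ] ℝ) := h ▸ trivial
      exact hu0 (dotProduct_self_eq_zero.1 this)
    refine measure_mono_null ?_ (Measure.addHaar_submodule volume _ hker)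
    intro p hp
    obtain ⟨g, hg, rfl⟩ := (Set.mem_finsetSum _ _ _).1 hp
    refine Submodule.sum_mem _ fun i hi => ?_
    refine convexHull_min (fun a ha => ?_) (Submodule.convex _) (hg hi)
    exact (dotProduct_comm u a).trans (hu i hi a ha)

end MomentMap

/-! ### Positivity of mixed volumes -/

section Positivity

variable {σ : Type*} [Fintype σ]

/-- The density whose integral is the mixed volume. -/
noncomputable def mixedDensity [DecidableEq σ] (A : σ → Finset (σ → ℝ)) (θ : σ → ℝ) : ℝ :=
  ∑ r ∈ Fintype.piFinset A, (∏ i, gibbsWeight (A i) θ (r i)) *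
    (Matrix.of fun i => r i - momentMap (A i) θ).det ^ 2

theorem mixedDensity_nonneg [DecidableEq σ] (A : σ → Finset (σ → ℝ)) (θ : σ → ℝ) :
    0 ≤ mixedDensity A θ :=
  sum_nonneg fun r _ => mul_nonneg
    (prod_nonneg fun i _ => (gibbsWeight_pos (A i) θ (r i)).le) (sq_nonneg _)

theorem continuous_det_sum_gibbsCov [DecidableEq σ] {ι : Type*} {A : ι → Finset (σ → ℝ)}
    (h0 : ∀ i, 0 ∈ A i) (I : Finset ι) :
    Continuous fun θ => (∑ i ∈ I, gibbsCov (A i) θ).det :=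
  Continuous.matrix_det (continuous_finsetSum _ fun i _ => continuous_gibbsCov ⟨0, h0 i⟩)

theorem integrable_det_sum_gibbsCov [DecidableEq σ] {ι : Type*} {A : ι → Finset (σ → ℝ)}
    (h0 : ∀ i, 0 ∈ A i) (I : Finset ι) :
    Integrable fun θ => (∑ i ∈ I, gibbsCov (A i) θ).det := by
  refine ⟨(continuous_det_sum_gibbsCov h0 I).aestronglyMeasurable, ?_⟩
  rw [hasFiniteIntegral_iff_ofReal
    (Eventually.of_forall fun θ => (posSemidef_sum_gibbsCov I θ).det_nonneg),
    ← volume_sum_convexHull h0 I]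
  exact (isCompact_sum_convexHull I).measure_lt_top

theorem toReal_volume_sum_convexHull [DecidableEq σ] {ι : Type*} {A : ι → Finset (σ → ℝ)}
    (h0 : ∀ i, 0 ∈ A i) (I : Finset ι) :
    (volume (∑ i ∈ I, convexHull ℝ (A i : Set (σ → ℝ)))).toReal =
      ∫ θ, (∑ i ∈ I, gibbsCov (A i) θ).det := by
  rw [volume_sum_convexHull h0, integral_eq_lintegral_of_nonneg_ae
    (Eventually.of_forall fun θ => (posSemidef_sum_gibbsCov I θ).det_nonneg)
    (continuous_det_sum_gibbsCov h0 I).aestronglyMeasurable]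

theorem mixedDensity_eq_sum [DecidableEq σ] (A : σ → Finset (σ → ℝ)) (θ : σ → ℝ) :
    mixedDensity A θ = ∑ I ∈ (univ : Finset σ).powerset,
      (-1 : ℝ) ^ (Fintype.card σ - #I) * (∑ i ∈ I, gibbsCov (A i) θ).det :=
  (sum_powerset_det_sum_vecMulVec A (fun i => gibbsWeight (A i) θ)
    fun i a => a - momentMap (A i) θ).symm

theorem continuous_mixedDensity [DecidableEq σ] {A : σ → Finset (σ → ℝ)} (h0 : ∀ i, 0 ∈ A i) :
    Continuous (mixedDensity A) := by
  rw [funext (mixedDensity_eq_sum A)]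
  exact continuous_finsetSum _ fun I _ =>
    continuous_const.mul (continuous_det_sum_gibbsCov h0 I)

theorem integrable_mixedDensity [DecidableEq σ] {A : σ → Finset (σ → ℝ)} (h0 : ∀ i, 0 ∈ A i) :
    Integrable (mixedDensity A) := by
  rw [funext (mixedDensity_eq_sum A)]
  exact integrable_finsetSum _ fun I _ => (integrable_det_sum_gibbsCov h0 I).const_mul _

/-- The mixed volume is the integral of a nonnegative density. -/
theorem mixedVolume_convexHull_eq_integral [DecidableEq σ] {A : σ → Finset (σ → ℝ)}
    (h0 : ∀ i, 0 ∈ A i) :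
    mixedVolume (fun i => convexHull ℝ (A i : Set (σ → ℝ))) = ∫ θ, mixedDensity A θ := by
  simp only [mixedVolume, mixedDensity_eq_sum, toReal_volume_sum_convexHull h0]
  rw [integral_finsetSum _ fun I _ => (integrable_det_sum_gibbsCov h0 I).const_mul _]
  exact sum_congr rfl fun I _ => (integral_const_mul _ _).symm

/-- Continuity upgrades vanishing almost everywhere to vanishing at every `θ`, so the density can be
tested at one chosen point. -/
theorem mixedVolume_convexHull_eq_zero_iff_mixedDensity [DecidableEq σ]
    {A : σ → Finset (σ → ℝ)} (h0 : ∀ i, 0 ∈ A i) :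
    mixedVolume (fun i => convexHull ℝ (A i : Set (σ → ℝ))) = 0 ↔ mixedDensity A = 0 := by
  rw [mixedVolume_convexHull_eq_integral h0,
    integral_eq_zero_iff_of_nonneg (fun θ => mixedDensity_nonneg A θ) (integrable_mixedDensity h0)]
  exact Continuous.ae_eq_iff_eq volume (continuous_mixedDensity h0) continuous_zero

theorem det_eq_zero_of_mixedDensity_eq_zero [DecidableEq σ] {A : σ → Finset (σ → ℝ)}
    {θ : σ → ℝ} (h : mixedDensity A θ = 0) {r : σ → σ → ℝ} (hr : ∀ i, r i ∈ A i) :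
    (Matrix.of fun i => r i - momentMap (A i) θ).det = 0 := by
  have h1 := (sum_eq_zero_iff_of_nonneg fun r _ => mul_nonneg
    (prod_nonneg fun i _ => (gibbsWeight_pos (A i) θ (r i)).le) (sq_nonneg _)).1 h r
    (Fintype.mem_piFinset.2 hr)
  have h2 : ∏ i, gibbsWeight (A i) θ (r i) ≠ 0 :=
    prod_ne_zero_iff.2 fun i _ => (gibbsWeight_pos (A i) θ (r i)).ne'
  exact pow_eq_zero_iff (two_ne_zero) |>.1 ((mul_eq_zero.1 h1).resolve_left h2)

/-- The mixed volume of polytopes through the origin vanishes if and only if no choice of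
spanning points, one from each, is linearly independent. -/
theorem mixedVolume_convexHull_eq_zero_iff [DecidableEq σ] {A : σ → Finset (σ → ℝ)}
    (h0 : ∀ i, 0 ∈ A i) :
    mixedVolume (fun i => convexHull ℝ (A i : Set (σ → ℝ))) = 0 ↔
      ∀ r : σ → σ → ℝ, (∀ i, r i ∈ A i) → (Matrix.of r).det = 0 := by
  rw [mixedVolume_convexHull_eq_zero_iff_mixedDensity h0]
  constructor
  · intro h r hr
    set μ : σ → σ → ℝ := fun i => momentMap (A i) 0 with hμ
    have e : (Matrix.of r).det = (detRowAlternating (n := σ) (R := ℝ)).toMultilinearMap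
        ((fun i => r i - μ i) + fun i => μ i) := by
      change (Matrix.of r).det = Matrix.det _
      congr 1
      ext i j
      simp
    rw [e, MultilinearMap.map_add_univ]
    refine sum_eq_zero fun s _ => ?_
    -- A row `μ i` is `-(0 - μ i)` and `0 ∈ A i`, so each term of the expansion is, up to sign, a
    -- determinant of centred rows.
    have h1 := det_eq_zero_of_mixedDensity_eq_zero (congrFun h 0)
      (r := fun i => if i ∈ s then r i else 0) (fun i => by split_ifs; exacts [hr i, h0 i])
    have h2 : (s.piecewise (fun i => r i - μ i) fun i => μ i) = fun i =>
        (if i ∈ s then (1 : ℝ) else -1) • ((if i ∈ s then r i else 0) - μ i) := by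
      funext i
      by_cases hi : i ∈ s <;> simp [hi]
    rw [h2, MultilinearMap.map_smul_univ]
    have h3 : (detRowAlternating (n := σ) (R := ℝ)).toMultilinearMap
        (fun i => (if i ∈ s then r i else 0) - μ i) = 0 := h1
    rw [h3, smul_zero]
  · intro h
    funext θ
    refine sum_eq_zero fun r hr => ?_
    rw [Fintype.mem_piFinset] at hr
    -- Each centred row is a weighted mean of differences `r i - a`; expanding these too leaves
    -- determinants of points of the `A i`.
    have e : (Matrix.of fun i => r i - momentMap (A i) θ) = Matrix.of fun i =>
        ∑ a ∈ A i, gibbsWeight (A i) θ a • (r i - a) := by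
      ext i j
      simp only [of_apply, smul_sub, sum_sub_distrib, ← sum_smul,
        sum_gibbsWeight ⟨0, h0 i⟩, one_smul]
      rfl
    have h1 : (Matrix.of fun i => ∑ a ∈ A i, gibbsWeight (A i) θ a • (r i - a)).det = 0 := by
      refine ((detRowAlternating (n := σ) (R := ℝ)).toMultilinearMap.map_sum_finset
        (fun i a => gibbsWeight (A i) θ a • (r i - a)) A).trans (sum_eq_zero fun s hs => ?_)
      rw [Fintype.mem_piFinset] at hs
      rw [MultilinearMap.map_smul_univ]
      have h4 : (detRowAlternating (n := σ) (R := ℝ)).toMultilinearMap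
          (fun i => r i - s i) = 0 := by
        have h5 : (fun i => r i - s i) = r + fun i => (-1 : ℝ) • s i := by
          funext i
          simp [sub_eq_add_neg]
        rw [h5, MultilinearMap.map_add_univ]
        refine sum_eq_zero fun t _ => ?_
        have h6 : (t.piecewise r fun i => (-1 : ℝ) • s i) = fun i =>
            (if i ∈ t then (1 : ℝ) else -1) • (if i ∈ t then r i else s i) := by
          funext i
          by_cases hi : i ∈ t <;> simp [hi]
        rw [h6, MultilinearMap.map_smul_univ]
        have h7 : (detRowAlternating (n := σ) (R := ℝ)).toMultilinearMap
            (fun i => if i ∈ t then r i else s i) = 0 :=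
          h (fun i => if i ∈ t then r i else s i)
            fun i => by split_ifs; exacts [hr i, hs i]
        rw [h7, smul_zero]
      rw [h4, smul_zero]
    rw [e, h1]
    simp

theorem mixedVolume_comp_equiv {ι κ : Type*} [Fintype ι] [Fintype κ] (e : κ ≃ ι)
    (P : ι → Set (σ → ℝ)) : mixedVolume (fun k => P (e k)) = mixedVolume P := by
  classical
  unfold mixedVolume
  refine sum_bij (fun I _ => I.map e.toEmbedding) ?_ ?_ ?_ ?_
  · intro I _
    simp
  · intro I _ J _ h
    exact map_injective _ h
  · intro J _
    refine ⟨J.map e.symm.toEmbedding, by simp, ?_⟩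
    ext x
    simp
  · intro I _
    rw [card_map, Fintype.card_congr e, sum_map]
    rfl

/-- The affine mixed volume of a square system is nonzero if and only if one can choose a
monomial from each polynomial such that the exponent vectors are linearly independent. -/
theorem affineMixedVolume_ne_zero_iff {ι : Type*} [Fintype ι]
    (h : Fintype.card ι = Fintype.card σ) (F : ι → MvPolynomial σ ℂ) :
    affineMixedVolume F ≠ 0 ↔ ∃ m : ι → σ →₀ ℕ, (∀ i, m i ∈ (F i).support) ∧
      LinearIndependent ℝ fun i (j : σ) => (m i j : ℝ) := by
  classical
  obtain ⟨e⟩ : Nonempty (σ ≃ ι) := ⟨(Fintype.equivOfCardEq h).symm⟩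
  set c : (σ →₀ ℕ) → σ → ℝ := fun m i => (m i : ℝ) with hc
  set A : σ → Finset (σ → ℝ) := fun i => insert 0 ((F (e i)).support.image c) with hA
  have h0 : ∀ i, 0 ∈ A i := fun i => mem_insert_self _ _
  have e1 : affineMixedVolume F = mixedVolume fun i => convexHull ℝ (A i : Set (σ → ℝ)) := by
    rw [affineMixedVolume, ← mixedVolume_comp_equiv e]
    simp [affineNewtonPolytope, hA, hc]
  rw [e1, Ne, mixedVolume_convexHull_eq_zero_iff h0]
  have hli : ∀ r : σ → σ → ℝ, (Matrix.of r).det ≠ 0 ↔ LinearIndependent ℝ r := by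
    intro r
    rw [← isUnit_iff_ne_zero, ← isUnit_iff_isUnit_det, ← linearIndependent_rows_iff_isUnit]
    rfl
  push Not
  constructor
  · rintro ⟨r, hr, hd⟩
    have hd' := (hli r).1 hd
    have hex : ∀ i, ∃ m ∈ (F (e i)).support, c m = r i := by
      intro i
      rcases mem_insert.1 (hr i) with h | h
      · exact absurd h (hd'.ne_zero i)
      · exact mem_image.1 h
    choose m hm hmr using hex
    refine ⟨fun i => m (e.symm i), fun i => by simpa using hm (e.symm i), ?_⟩
    have : (fun i => c (m (e.symm i))) = r ∘ e.symm := by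
      funext i
      exact hmr _
    change LinearIndependent ℝ fun i => c (m (e.symm i))
    rw [this]
    exact hd'.comp _ e.symm.injective
  · rintro ⟨m, hm, hl⟩
    refine ⟨fun i => c (m (e i)), fun i => ?_, ?_⟩
    · exact mem_insert_of_mem (mem_image_of_mem _ (hm (e i)))
    · exact (hli _).2 (hl.comp e e.injective)

theorem apply_eq_zero_of_mem_supported {σ : Type*} {s : Set σ} {p : MvPolynomial σ ℂ}
    (hp : p ∈ MvPolynomial.supported ℂ s) {m : σ →₀ ℕ} (hm : m ∈ p.support) {j : σ}
    (hj : j ∉ s) : m j = 0 := by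
  by_contra h
  exact hj (MvPolynomial.mem_supported.1 hp
    ((MvPolynomial.mem_vars_iff_mem_support j).2 ⟨m, hm, Finsupp.mem_support_iff.2 h⟩))

/-- If some of the polynomials only involve a smaller number of variables, then the affine mixed
volume vanishes. -/
theorem affineMixedVolume_eq_zero_of_mem_supported {ι : Type*} [Fintype ι]
    (h : Fintype.card ι = Fintype.card σ) (F : ι → MvPolynomial σ ℂ) (I : Finset ι)
    (W : Finset σ) (hIW : #W < #I)
    (hF : ∀ i ∈ I, F i ∈ MvPolynomial.supported ℂ (W : Set σ)) : affineMixedVolume F = 0 := by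
  by_contra hne
  obtain ⟨m, hm, hl⟩ := (affineMixedVolume_ne_zero_iff h F).1 hne
  have h1 : LinearIndependent ℝ fun (i : I) (j : σ) => (m i j : ℝ) :=
    hl.comp (fun i : I => (i : ι)) Subtype.val_injective
  -- The exponents of these polynomials vanish outside `W`, so dropping the other coordinates keeps
  -- independence and bounds `#I` by `#W`.
  have h2 : LinearIndependent ℝ fun (i : I) (j : W) => (m i j : ℝ) := by
    rw [Fintype.linearIndependent_iff] at h1 ⊢
    intro g hg
    refine h1 g (funext fun j => ?_)
    by_cases hj : j ∈ W
    · have := congrFun hg ⟨j, hj⟩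
      simpa [Finset.sum_apply] using this
    · simp only [Finset.sum_apply, Pi.smul_apply, smul_eq_mul, Pi.zero_apply]
      exact sum_eq_zero fun i _ => by
        rw [apply_eq_zero_of_mem_supported (hF i i.2) (hm i) hj, Nat.cast_zero, mul_zero]
  have h3 := h2.fintype_card_le_finrank
  rw [Module.finrank_fintype_fun_eq_card, Fintype.card_coe, Fintype.card_coe] at h3
  omega

end Positivity

end Heron

namespace Heron

open Finset Matrix MvPolynomial

/-! ### The Jacobian criterion -/

section Jacobian

variable {ι σ : Type*} [Fintype ι]

theorem pderiv_aeval (F : ι → MvPolynomial σ ℂ) (j : σ) (p : MvPolynomial ι ℂ) :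
    pderiv j (aeval F p) = ∑ i, aeval F (pderiv i p) * pderiv j (F i) := by
  classical
  induction p using MvPolynomial.induction_on with
  | C a => simp
  | add p q hp hq => simp only [map_add, hp, hq, add_mul, sum_add_distrib]
  | mul_X p i hp =>
    have h : ∀ k, aeval F (pderiv k (p * X i)) * pderiv j (F k) =
        aeval F (pderiv k p) * pderiv j (F k) * F i +
          if k = i then aeval F p * pderiv j (F i) else 0 := by
      intro k
      rw [pderiv_mul, map_add, map_mul, map_mul, aeval_X]
      split_ifs with hk
      · rw [hk, pderiv_X_self, map_one]
        ring
      · rw [pderiv_X_of_ne (Ne.symm hk), map_zero]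
        ring
    simp only [h, sum_add_distrib, sum_ite_eq', mem_univ, if_true]
    rw [map_mul, aeval_X, pderiv_mul, hp, sum_mul]

theorem eq_C_of_pderiv_eq_zero {p : MvPolynomial ι ℂ} (h : ∀ i, pderiv i p = 0) :
    p = C (coeff 0 p) := by
  classical
  ext m
  rw [coeff_C]
  split_ifs with hm
  · rw [← hm]
  · obtain ⟨i, hi⟩ : ∃ i, m i ≠ 0 := by
      by_contra! h0
      exact hm (Finsupp.ext fun i => (h0 i).symm)
    have h1 := coeff_pderiv p (i := i) (m - Finsupp.single i 1)
    rw [h i, coeff_zero, tsub_add_cancel_of_le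
      (Finsupp.single_le_iff.2 (Nat.one_le_iff_ne_zero.2 hi))] at h1
    exact (mul_eq_zero.1 h1.symm).resolve_right (Nat.cast_add_one_ne_zero _)

theorem totalDegree_pderiv_lt {p : MvPolynomial ι ℂ} {i : ι} (h : pderiv i p ≠ 0) :
    (pderiv i p).totalDegree < p.totalDegree := by
  classical
  obtain ⟨m, hm, hd⟩ := exists_mem_eq_sup (pderiv i p).support (support_nonempty.2 h)
    fun m => m.degree
  have h1 : (pderiv i p).totalDegree = m.degree := hd
  have h2 : m + Finsupp.single i 1 ∈ p.support := by
    rw [mem_support_iff] at hm ⊢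
    intro h0
    rw [coeff_pderiv, h0, zero_mul] at hm
    exact hm rfl
  have h3 : (m + Finsupp.single i 1).degree ≤ p.totalDegree := le_totalDegree h2
  rw [map_add, Finsupp.degree_single] at h3
  omega

variable [Fintype σ]

theorem det_pderiv_ne_zero [DecidableEq σ] (e : σ ≃ ι) {F : ι → MvPolynomial σ ℂ} {x : σ → ℂ}
    (hli : LinearIndependent ℂ fun i j => eval x (pderiv j (F i))) :
    (Matrix.of fun i j => pderiv j (F (e i))).det ≠ 0 := by
  set J : Matrix σ σ (MvPolynomial σ ℂ) := Matrix.of fun i j => pderiv j (F (e i)) with hJ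
  intro h0
  have h1 : ((eval x).mapMatrix J).det = 0 := by rw [← RingHom.map_det, h0, map_zero]
  have h2 : LinearIndependent ℂ ((eval x).mapMatrix J).row := hli.comp e e.injective
  rw [linearIndependent_rows_iff_isUnit, isUnit_iff_isUnit_det, h1] at h2
  exact not_isUnit_zero h2

/-- Independence at one point makes the Jacobian determinant a nonzero polynomial, so the Jacobian
matrix has trivial left kernel over the polynomial ring. -/
theorem eq_zero_of_sum_mul_pderiv_eq_zero (hc : Fintype.card ι = Fintype.card σ)
    {F : ι → MvPolynomial σ ℂ} {x : σ → ℂ}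
    (hli : LinearIndependent ℂ fun i j => eval x (pderiv j (F i))) {q : ι → MvPolynomial σ ℂ}
    (hq : ∀ j, ∑ i, q i * pderiv j (F i) = 0) : q = 0 := by
  classical
  obtain ⟨e⟩ : Nonempty (σ ≃ ι) := ⟨(Fintype.equivOfCardEq hc).symm⟩
  set J : Matrix σ σ (MvPolynomial σ ℂ) := Matrix.of fun i j => pderiv j (F (e i)) with hJ
  have hdet : J.det ≠ 0 := det_pderiv_ne_zero e hli
  have h3 : (fun i => q (e i)) ᵥ* J = 0 := by
    funext j
    rw [Pi.zero_apply, ← hq j, ← Equiv.sum_comp e]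
    rfl
  have h4 : (fun i => q (e i)) = 0 := by
    by_contra hne
    exact hdet (exists_vecMul_eq_zero_iff.1 ⟨_, hne, h3⟩)
  funext i
  simpa using congrFun h4 (e.symm i)

/-- Polynomials whose gradients are linearly independent at some point are algebraically
independent. -/
theorem algebraicIndependent_of_linearIndependent_gradient
    (hc : Fintype.card ι = Fintype.card σ) {F : ι → MvPolynomial σ ℂ} {x : σ → ℂ}
    (hli : LinearIndependent ℂ fun i j => eval x (pderiv j (F i))) :
    AlgebraicIndependent ℂ F := by
  rw [algebraicIndependent_iff]
  intro p
  induction hn : p.totalDegree using Nat.strong_induction_on generalizing p with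
  | _ n ih =>
    intro hp
    -- By the chain rule the partial derivatives of a relation are again relations, of smaller
    -- degree; by induction they vanish, so `p` is constant.
    have h1 : (fun i => aeval F (pderiv i p)) = 0 := by
      refine eq_zero_of_sum_mul_pderiv_eq_zero hc hli fun j => ?_
      rw [← pderiv_aeval, hp, map_zero]
    have h2 : ∀ i, pderiv i p = 0 := by
      intro i
      by_contra hne
      exact hne (ih _ (hn ▸ totalDegree_pderiv_lt hne) _ rfl (congrFun h1 i))
    rw [eq_C_of_pderiv_eq_zero h2] at hp ⊢
    rw [aeval_C, algebraMap_eq, C_eq_zero] at hp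
    rw [hp, C_0]

/-- The Euler operator scales each monomial by its exponent, which is how exponent vectors enter the
Jacobian. -/
theorem X_mul_pderiv_eq_sum (f : MvPolynomial σ ℂ) (j : σ) :
    X j * pderiv j f =
      ∑ m ∈ f.support, monomial m (coeff m f) * ((m j : ℕ) : MvPolynomial σ ℂ) := by
  conv_lhs => rw [f.as_sum]
  rw [map_sum, mul_sum]
  refine sum_congr rfl fun m _ => ?_
  rw [X_mul_pderiv_monomial, nsmul_eq_mul, mul_comm]

/-- If the Jacobian determinant of a square system is nonzero at some point, then its affine mixed
volume is nonzero. -/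
theorem affineMixedVolume_ne_zero_of_linearIndependent_gradient
    (hc : Fintype.card ι = Fintype.card σ) {F : ι → MvPolynomial σ ℂ} {x : σ → ℂ}
    (hli : LinearIndependent ℂ fun i j => eval x (pderiv j (F i))) :
    affineMixedVolume F ≠ 0 := by
  classical
  rw [affineMixedVolume_ne_zero_iff hc]
  by_contra! hno
  obtain ⟨e⟩ : Nonempty (σ ≃ ι) := ⟨(Fintype.equivOfCardEq hc).symm⟩
  set J : Matrix σ σ (MvPolynomial σ ℂ) := Matrix.of fun i j => pderiv j (F (e i)) with hJ
  have hdet : J.det ≠ 0 := det_pderiv_ne_zero e hli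
  have hexp : ∀ m : σ → σ →₀ ℕ, (∀ i, m i ∈ (F (e i)).support) →
      (Matrix.of fun i j => ((m i j : ℕ) : MvPolynomial σ ℂ)).det = 0 := by
    intro m hm
    have h1 := hno (fun i => m (e.symm i)) fun i => by simpa using hm (e.symm i)
    have h2 : (Matrix.of fun i j => ((m i j : ℕ) : ℝ)).det = 0 := by
      by_contra hne
      have h3 : LinearIndependent ℝ (Matrix.of fun i j => ((m i j : ℕ) : ℝ)).row := by
        rw [linearIndependent_rows_iff_isUnit, isUnit_iff_isUnit_det]
        exact isUnit_iff_ne_zero.2 hne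
      exact h1 (h3.comp e.symm e.symm.injective)
    -- The vanishing determinant is transported from `ℝ` to the polynomial ring through `ℤ`.
    set N : Matrix σ σ ℤ := Matrix.of fun i j => (m i j : ℤ) with hN
    have h4 : (Matrix.of fun i j => ((m i j : ℕ) : ℝ)) = (Int.castRingHom ℝ).mapMatrix N := by
      ext i j
      simp [hN]
    have h5 : (Matrix.of fun i j => ((m i j : ℕ) : MvPolynomial σ ℂ)) =
        (Int.castRingHom (MvPolynomial σ ℂ)).mapMatrix N := by
      ext1 i j
      simp [hN]
    rw [h4, ← RingHom.map_det] at h2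
    have h6 : N.det = 0 := by simpa using h2
    rw [h5, ← RingHom.map_det, h6, map_zero]
  -- With column `j` multiplied by `X j`, each row is a combination of exponent vectors, and the
  -- determinant expands into exponent determinants.
  have hprod : (∏ j, (X j : MvPolynomial σ ℂ)) * J.det = 0 := by
    rw [← det_mul_row]
    have e1 : (Matrix.of fun i j => X j * J i j) = Matrix.of fun i =>
        ∑ m ∈ (F (e i)).support, monomial m (coeff m (F (e i))) •
          fun j => ((m j : ℕ) : MvPolynomial σ ℂ) := by
      ext1 i j
      simp [hJ, X_mul_pderiv_eq_sum, Finset.sum_apply]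
    rw [e1]
    refine ((detRowAlternating (n := σ) (R := MvPolynomial σ ℂ)).toMultilinearMap.map_sum_finset
      (fun i m => monomial m (coeff m (F (e i))) • fun j => ((m j : ℕ) : MvPolynomial σ ℂ))
      fun i => (F (e i)).support).trans (sum_eq_zero fun m hm => ?_)
    rw [Fintype.mem_piFinset] at hm
    rw [MultilinearMap.map_smul_univ]
    exact (congrArg _ (hexp m hm)).trans (smul_zero _)
  exact (mul_ne_zero (prod_ne_zero_iff.2 fun j _ => X_ne_zero j) hdet) hprod

end Jacobian

/-! ### Algebraic matroids of graphs of polynomial maps -/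

section Dominance

variable {ι σ : Type} [Fintype σ]

theorem card_le_of_algebraicIndependent [Fintype ι] {F : ι → MvPolynomial σ ℂ}
    (h : AlgebraicIndependent ℂ F) : Fintype.card ι ≤ Fintype.card σ := by
  have := h.cardinalMk_le_trdeg
  simpa using this

theorem card_le_of_algebraicIndependent_of_supported [Fintype ι] {F : ι → MvPolynomial σ ℂ}
    (h : AlgebraicIndependent ℂ F) {W : Finset σ} (hW : ∀ i, F i ∈ supported ℂ (W : Set σ)) :
    Fintype.card ι ≤ #W := by
  have hex : ∀ i, ∃ q : MvPolynomial W ℂ, rename ((↑) : W → σ) q = F i := by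
    intro i
    have h1 := hW i
    rw [supported_eq_range_rename] at h1
    exact h1
  choose q hq using hex
  have h2 : AlgebraicIndependent ℂ q := by
    refine AlgebraicIndependent.of_comp (rename ((↑) : W → σ)) ?_
    rwa [show (rename ((↑) : W → σ) ∘ q) = F from _root_.funext hq]
  simpa using card_le_of_algebraicIndependent h2

theorem eval_eval_eq_eval_aeval {τ : Type} (F : ι → MvPolynomial τ ℂ) (t : τ → ℂ)
    (p : MvPolynomial ι ℂ) : eval (fun i => eval t (F i)) p = eval t (aeval F p) :=
  (DFunLike.congr_fun (comp_aeval F (aeval t : MvPolynomial τ ℂ →ₐ[ℂ] ℂ)) p).symm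

/-- The coordinates of a polynomial map are algebraically independent if and only if the map is
dominant. -/
theorem zariskiClosure_range_eq_univ_iff {F : ι → MvPolynomial σ ℂ} :
    zariskiClosure (Set.range fun (t : σ → ℂ) i => eval t (F i)) = Set.univ ↔
      AlgebraicIndependent ℂ F := by
  rw [algebraicIndependent_iff]
  constructor
  · intro h p hp
    have hmem : p ∈ vanishingIdeal ℂ (Set.range fun (t : σ → ℂ) i => eval t (F i)) := by
      rintro _ ⟨t, rfl⟩
      exact (eval_eval_eq_eval_aeval F t p).trans (by rw [hp, map_zero])
    refine MvPolynomial.funext fun x => ?_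
    have hx : x ∈ zariskiClosure (Set.range fun (t : σ → ℂ) i => eval t (F i)) := h ▸ trivial
    rw [map_zero, ← hx p hmem]
    rfl
  · intro h
    refine Set.eq_univ_of_forall fun x p hp => ?_
    rw [h p (MvPolynomial.funext fun t => ?_), map_zero]
    rw [← eval_eval_eq_eval_aeval, map_zero]
    exact hp _ ⟨t, rfl⟩

/-- As many algebraically independent polynomials as there are variables generically determine
each coordinate up to finitely many choices. -/
theorem exists_finite_coordinate [Fintype ι] (hc : Fintype.card ι = Fintype.card σ)
    {F : ι → MvPolynomial σ ℂ} (j : σ) :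
    ∃ g : MvPolynomial ι ℂ, g ≠ 0 ∧ ∀ b : ι → ℂ, eval b g ≠ 0 → ∃ R : Set ℂ, R.Finite ∧
      ∀ t : σ → ℂ, (∀ i, eval t (F i) = b i) → t j ∈ R := by
  -- Adjoining `X j` exceeds the transcendence degree. The resulting relation, read as a univariate
  -- polynomial in the slot of `X j`, has `t j` as a root, and is nonzero wherever its leading
  -- coefficient is.
  have hdep : ¬ AlgebraicIndependent ℂ (fun o : Option ι => o.elim (X j) F) := by
    intro h
    have := card_le_of_algebraicIndependent h
    rw [Fintype.card_option] at this
    omega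
  rw [algebraicIndependent_iff] at hdep
  push Not at hdep
  obtain ⟨p, hp, hp0⟩ := hdep
  set P := optionEquivLeft ℂ ι p with hP
  have hP0 : P ≠ 0 := by
    rw [hP, Ne, EmbeddingLike.map_eq_zero_iff]
    exact hp0
  refine ⟨P.leadingCoeff, Polynomial.leadingCoeff_ne_zero.2 hP0, fun b hb => ?_⟩
  have hPb : P.map (eval b) ≠ 0 := by
    intro h
    have := congrArg (fun Q => Polynomial.coeff Q P.natDegree) h
    simp only [Polynomial.coeff_map, Polynomial.coeff_zero] at this
    exact hb this
  refine ⟨{z | (P.map (eval b)).IsRoot z}, Polynomial.finite_setOfPred_isRoot hPb, fun t ht => ?_⟩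
  have h1 := optionEquivLeft_elim_eval _ _ b (t j) p
  have h2 : (fun o : Option ι => o.elim (t j) b) =
      fun o : Option ι => eval t (o.elim (X j) F) := by
    funext o
    cases o <;> simp [ht]
  rw [h2, eval_eval_eq_eval_aeval, hp, map_zero] at h1
  exact h1.symm

end Dominance

/-! ### The Heron variety as a graph over the edge coordinates -/

section HeronVariety

variable {n : ℕ}

/-- The squared volumes of all faces as functions of the squared edge lengths. -/
noncomputable def volMap (n : ℕ) (t : Edge n → ℂ) (S : Face n) : ℂ := eval t (sqVol S)

theorem sqDist_self (i : Fin (n + 1)) : sqDist i i = 0 := dif_pos rfl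

theorem sqDist_comm (i j : Fin (n + 1)) : sqDist i j = sqDist j i := by
  unfold sqDist
  split_ifs with h1 h2 h2
  · rfl
  · exact absurd h1.symm h2
  · exact absurd h2.symm h1
  · congr 2
    exact pair_comm i j

/-- The Cayley-Menger determinant in terms of an enumeration of the vertices. -/
theorem det_cayleyMenger {k : ℕ} {g : Fin k → Fin (n + 1)} (hg : Function.Injective g)
    {S : Finset (Fin (n + 1))} (hS : S = univ.image g) :
    (cayleyMenger S).det = (Matrix.of (vecCons (vecCons (0 : MvPolynomial (Edge n) ℂ) fun _ => 1)
      fun i => vecCons 1 fun j => sqDist (g i) (g j))).det := by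
  subst hS
  set f : Fin k ≃ univ.image g := Equiv.ofBijective
    (fun i => ⟨g i, mem_image_of_mem g (mem_univ i)⟩)
    ⟨fun i j h => hg (congrArg Subtype.val h), by
      rintro ⟨x, hx⟩
      obtain ⟨i, _, rfl⟩ := mem_image.1 hx
      exact ⟨i, rfl⟩⟩ with hf
  have hfg : ∀ i, (f i : Fin (n + 1)) = g i := fun i => rfl
  rw [← det_submatrix_equiv_self ((finSuccEquiv k).trans (Equiv.optionCongr f))]
  congr 1
  ext1 a b
  refine Fin.cases ?_ (fun i => ?_) a <;> refine Fin.cases ?_ (fun j => ?_) b <;>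
  simp [cayleyMenger, hfg]

theorem sqVol_toFace (e : Edge n) : sqVol e.toFace = X e := by
  obtain ⟨i, j, hij, he⟩ := card_eq_two.1 e.2
  have hc : e.toFace.1.card = 2 := e.2
  have hX : sqDist i j = X e := by
    rw [sqDist, dif_neg hij]
    congr 1
    exact Subtype.ext he.symm
  have hdet : (cayleyMenger e.toFace.1).det = 2 * X e := by
    rw [det_cayleyMenger (g := ![i, j]) (S := e.toFace.1)
      (by intro a b; fin_cases a <;> fin_cases b <;> simp [hij, hij.symm])
      (by
        change e.1 = _
        rw [he]
        ext x
        simp [Fin.exists_fin_succ, eq_comm])]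
    simp [det_succ_row_zero, Fin.sum_univ_succ, sqDist_self, sqDist_comm j i, hX, Fin.succAbove]
    ring
  rw [sqVol, hc, hdet]
  have h2 : (2 : MvPolynomial (Edge n) ℂ) = C 2 := rfl
  rw [h2, ← mul_assoc, ← C_mul]
  norm_num

theorem sqVol_mem_supported (S : Face n) :
    sqVol S ∈ supported ℂ {e : Edge n | e.1 ⊆ S.1} := by
  refine Subalgebra.mul_mem _ (Subalgebra.algebraMap_mem _ _) ?_
  rw [det_apply]
  refine Subalgebra.sum_mem _ fun τ _ => ?_
  rw [Units.smul_def]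
  refine Subalgebra.zsmul_mem _ (Subalgebra.prod_mem _ fun a _ => ?_) _
  rcases h1 : τ a with _ | i <;> rcases a with _ | j <;>
    simp only [cayleyMenger, of_apply]
  · exact Subalgebra.zero_mem _
  · exact Subalgebra.one_mem _
  · exact Subalgebra.one_mem _
  · unfold sqDist
    split_ifs with h
    · exact Subalgebra.zero_mem _
    · rw [X_mem_supported]
      change ({i.1, j.1} : Finset _) ⊆ S.1
      simp [insert_subset_iff]

/-- The edge coordinates of `φ` are the parameters themselves, so its image is the graph cut out by
the polynomials `X S - rename Edge.toFace (sqVol S)` and is already closed. -/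
theorem mem_heronVariety_iff {x : Face n → ℂ} :
    x ∈ heronVariety n ↔ volMap n (fun e => x e.toFace) = x := by
  constructor
  · intro hx
    funext S
    have hmem : X S - rename Edge.toFace (sqVol S) ∈ vanishingIdeal ℂ
        (Set.range fun (x : Edge n → ℂ) (S : Face n) => eval x (sqVol S)) := by
      rintro _ ⟨t, rfl⟩
      rw [map_sub, aeval_X, aeval_rename]
      simp only [Function.comp_def, sqVol_toFace, eval_X]
      exact sub_self _
    have h := hx _ hmem
    rw [map_sub, aeval_X, aeval_rename, sub_eq_zero] at h
    exact h.symm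
  · intro h p hp
    exact hp x ⟨_, h⟩

theorem coordProj_image_heronVariety (B : Finset (Face n)) :
    coordProj B '' heronVariety n =
      Set.range fun (t : Edge n → ℂ) (S : B) => eval t (sqVol S.1) := by
  ext y
  constructor
  · rintro ⟨x, hx, rfl⟩
    exact ⟨fun e => x e.toFace, funext fun S => congrFun (mem_heronVariety_iff.1 hx) S.1⟩
  · rintro ⟨t, rfl⟩
    refine ⟨volMap n t, mem_heronVariety_iff.2 ?_, rfl⟩
    congr 1
    funext e
    rw [volMap, sqVol_toFace, eval_X]

/-- Generic finiteness is automatic for this cardinality: each edge coordinate takes finitely many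
values on a generic fibre, and the edges determine the point. -/
theorem isAlgebraicBasis_heronVariety_iff {B : Finset (Face n)}
    (hB : #B = Fintype.card (Edge n)) :
    IsAlgebraicBasis (heronVariety n) B ↔ AlgebraicIndependent ℂ fun S : B => sqVol S.1 := by
  rw [IsAlgebraicBasis, coordProj_image_heronVariety, zariskiClosure_range_eq_univ_iff]
  refine and_iff_left_of_imp fun _ => ?_
  have hc : Fintype.card B = Fintype.card (Edge n) := by rw [Fintype.card_coe, hB]
  choose g hg0 hg using exists_finite_coordinate hc (F := fun S : B => sqVol S.1)
  refine ⟨∏ j, g j, prod_ne_zero_iff.2 fun j _ => hg0 j, fun b hb => ?_⟩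
  rw [map_prod, prod_ne_zero_iff] at hb
  choose R hR hRt using fun j => hg j b (hb j (mem_univ j))
  refine ((Set.Finite.pi fun j => hR j).image (volMap n)).subset ?_
  rintro x ⟨hx, hxb⟩
  rw [mem_heronVariety_iff] at hx
  refine ⟨fun e => x e.toFace, fun j _ => hRt j (fun e => x e.toFace) fun S => ?_, hx⟩
  rw [← hxb]
  exact congrFun hx S.1

end HeronVariety

theorem aeval_mem_supported {σ τ : Type*} {s : Set σ} {s' : Set τ} {p : MvPolynomial σ ℂ}
    (hp : p ∈ supported ℂ s) {f : σ → MvPolynomial τ ℂ} (hf : ∀ j ∈ s, f j ∈ supported ℂ s') :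
    aeval f p ∈ supported ℂ s' := by
  have h : supported ℂ s ≤
      (supported ℂ s').comap (aeval f : MvPolynomial σ ℂ →ₐ[ℂ] MvPolynomial τ ℂ) := by
    rw [supported_eq_adjoin_X, Algebra.adjoin_le_iff]
    rintro _ ⟨j, hj, rfl⟩
    change aeval f (X j : MvPolynomial σ ℂ) ∈ supported ℂ s'
    rw [aeval_X]
    exact hf j hj
  exact h hp

/-! ### The two square systems of a set of faces -/

section Systems

variable {n : ℕ}

/-- The edges are the positive-dimensional faces with at most two vertices. -/
def edgeEquiv (n : ℕ) : Edge n ≃ {S : Face n // ¬ 2 < S.1.card} where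
  toFun e := ⟨e.toFace, fun h => by
    have h1 : e.toFace.1.card = 2 := e.2
    omega⟩
  invFun S := ⟨S.1.1, by
    have h1 := S.1.2
    have h2 := S.2
    omega⟩
  left_inv _ := rfl
  right_inv _ := rfl

theorem toFace_injective : Function.Injective (Edge.toFace (n := n)) := fun _ _ h =>
  Subtype.ext (congrArg (fun S : Face n => S.1) h)

theorem card_face_eq : Fintype.card (Face n) =
    Fintype.card {S : Face n // 2 < S.1.card} + Fintype.card (Edge n) := by
  rw [Fintype.card_congr (edgeEquiv n), Fintype.card_subtype_compl]
  have := Fintype.card_subtype_le fun S : Face n => 2 < S.1.card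
  omega

theorem sum_face {M : Type*} [AddCommMonoid M] (f : Face n → M) :
    ∑ S, f S = ∑ T : {S : Face n // 2 < S.1.card}, f T.1 + ∑ e : Edge n, f e.toFace := by
  rw [← Fintype.sum_subtype_add_sum_subtype (fun S : Face n => 2 < S.1.card) f,
    ← Equiv.sum_comp (edgeEquiv n)]
  rfl

theorem card_fibreSystem {B : Finset (Face n)} (hB : #B = Fintype.card (Edge n)) :
    Fintype.card (Face n) = Fintype.card (Edge n ⊕ {S : Face n // S ∉ B}) := by
  rw [Fintype.card_sum, Fintype.card_subtype_compl, Fintype.card_coe, hB]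
  have := card_face_eq (n := n)
  omega

theorem card_implicitFibreSystem {B : Finset (Face n)} (hB : #B = Fintype.card (Edge n)) :
    Fintype.card {S : Face n // 2 < S.1.card} = Fintype.card {S : Face n // S ∉ B} := by
  rw [Fintype.card_subtype_compl (fun S : Face n => S ∈ B), Fintype.card_coe, hB]
  have := card_face_eq (n := n)
  omega

/-! ### Sets of faces with too few edges -/

/-- The faces in `B` all of whose edges belong to `W`. -/
def facesWithin (B : Finset (Face n)) (W : Finset (Edge n)) : Finset (Face n) :=
  {S ∈ B | ∀ e : Edge n, e.1 ⊆ S.1 → e ∈ W}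

variable {B : Finset (Face n)} {W : Finset (Edge n)}

theorem sqVol_mem_supported_of_mem_facesWithin {S : Face n} (hS : S ∈ facesWithin B W) :
    sqVol S ∈ supported ℂ (W : Set (Edge n)) :=
  supported_mono (fun e he => (mem_filter.1 hS).2 e he) (sqVol_mem_supported S)

theorem not_algebraicIndependent_of_lt_facesWithin (h : #W < #(facesWithin B W)) :
    ¬ AlgebraicIndependent ℂ fun S : B => sqVol S.1 := by
  intro hai
  have hsub : facesWithin B W ⊆ B := filter_subset _ _
  have h1 : AlgebraicIndependent ℂ fun S : facesWithin B W => sqVol S.1 :=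
    hai.comp (fun S : facesWithin B W => (⟨S.1, hsub S.2⟩ : B))
      fun _ _ h => Subtype.ext (congrArg (fun S : B => S.1) h)
  have h2 := card_le_of_algebraicIndependent_of_supported h1
    fun S => sqVol_mem_supported_of_mem_facesWithin S.2
  rw [Fintype.card_coe] at h2
  omega

/-- Equations of faces in `B` contain no auxiliary unknown `x_S`, so those in `facesWithin B W`
involve only the edge variables in `W`. -/
theorem affineMixedVolume_fibreSystem_eq_zero (hB : #B = Fintype.card (Edge n))
    (h : #W < #(facesWithin B W)) (b : B → ℂ) :
    affineMixedVolume (fibreSystem sqVol B b) = 0 := by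
  refine affineMixedVolume_eq_zero_of_mem_supported (card_fibreSystem hB) _ (facesWithin B W)
    (W.map ⟨Sum.inl, Sum.inl_injective⟩) (by rwa [card_map]) fun S hS => ?_
  rw [fibreSystem, dif_pos (filter_subset _ _ hS)]
  refine Subalgebra.sub_mem _ ?_ (Subalgebra.algebraMap_mem _ _)
  rw [rename_eq_aeval]
  refine aeval_mem_supported (sqVol_mem_supported_of_mem_facesWithin hS) fun e he => ?_
  exact X_mem_supported.2 (by simpa using he)

/-- Each edge of `W` that lies in `B` is itself in `facesWithin B W`. Substituting its value removes
one unknown and one face from the count, so the excess of equations over unknowns persists. -/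
theorem affineMixedVolume_implicitFibreSystem_eq_zero (hB : #B = Fintype.card (Edge n))
    (h : #W < #(facesWithin B W)) (b : B → ℂ) :
    affineMixedVolume (implicitFibreSystem B b) = 0 := by
  classical
  set I : Finset {S : Face n // 2 < S.1.card} := {T | T.1 ∈ facesWithin B W} with hI
  set V : Finset {S : Face n // S ∉ B} := {S | ∃ e ∈ W, e.toFace = S.1} with hV
  have h1 : #(facesWithin B W) ≤ #I + #{e ∈ W | e.toFace ∈ B} := by
    rw [← card_map (s := I) (Function.Embedding.subtype _),
      ← card_map (s := {e ∈ W | e.toFace ∈ B}) ⟨Edge.toFace, toFace_injective⟩]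
    refine (card_le_card (t := I.map (Function.Embedding.subtype _) ∪
      {e ∈ W | e.toFace ∈ B}.map ⟨Edge.toFace, toFace_injective⟩) fun S hS => ?_).trans
        (card_union_le _ _)
    rw [mem_union]
    by_cases hS2 : 2 < S.1.card
    · exact Or.inl (mem_map.2 ⟨⟨S, hS2⟩, by simpa [hI] using hS, rfl⟩)
    · refine Or.inr (mem_map.2 ⟨(edgeEquiv n).symm ⟨S, hS2⟩, ?_, rfl⟩)
      exact mem_filter.2 ⟨(mem_filter.1 hS).2 _ (Subset.refl _), (mem_filter.1 hS).1⟩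
  have h2 : #V ≤ #{e ∈ W | e.toFace ∉ B} := by
    rw [← card_map (Function.Embedding.subtype _), ← card_map ⟨Edge.toFace, toFace_injective⟩]
    refine card_le_card fun S hS => ?_
    obtain ⟨S', hS', rfl⟩ := mem_map.1 hS
    obtain ⟨e, he, heS⟩ := (mem_filter.1 hS').2
    exact mem_map.2 ⟨e, mem_filter.2 ⟨he, heS ▸ S'.2⟩, heS⟩
  have h3 := card_filter_add_card_filter_not (s := W) (fun e => e.toFace ∈ B)
  refine affineMixedVolume_eq_zero_of_mem_supported (card_implicitFibreSystem hB) _ I V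
    (by omega) fun T hT => ?_
  have hTW : T.1 ∈ facesWithin B W := by simpa [hI] using hT
  have hTB : T.1 ∈ B := filter_subset _ _ hTW
  rw [implicitFibreSystem, heronEquation, map_sub, aeval_X, dif_pos hTB, aeval_rename]
  refine Subalgebra.sub_mem _ (Subalgebra.algebraMap_mem _ _) ?_
  refine aeval_mem_supported (sqVol_mem_supported_of_mem_facesWithin hTW) fun e he => ?_
  simp only [Function.comp_apply]
  split_ifs with heB
  · exact Subalgebra.algebraMap_mem _ _
  · exact X_mem_supported.2 (mem_filter.2 ⟨mem_univ _, e, he, rfl⟩)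

/-! ### Sets of faces with linearly independent gradients -/

theorem sum_eq_sum_coe_of_eq_zero {ι M : Type*} [Fintype ι] [AddCommMonoid M] {B : Finset ι}
    {f : ι → M} (h : ∀ i ∉ B, f i = 0) : ∑ i, f i = ∑ i : B, f i := by
  rw [sum_coe_sort]
  exact (sum_subset (subset_univ B) fun i _ hi => h i hi).symm

/-- The column of `x_S` has its only nonzero entry, `-1`, in row `S`, so a relation between the rows
is supported on `B`. The constants `b` drop out of the Jacobian, hence no genericity is required. -/
theorem affineMixedVolume_fibreSystem_ne_zero (hB : #B = Fintype.card (Edge n))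
    {t : Edge n → ℂ} (ht : LinearIndependent ℂ fun (S : B) e => eval t (pderiv e (sqVol S.1)))
    (b : B → ℂ) : affineMixedVolume (fibreSystem sqVol B b) ≠ 0 := by
  classical
  refine affineMixedVolume_ne_zero_of_linearIndependent_gradient (card_fibreSystem hB)
    (x := Sum.elim t 0) ?_
  have hl : ∀ S e, eval (Sum.elim t 0) (pderiv (Sum.inl e) (fibreSystem sqVol B b S)) =
      eval t (pderiv e (sqVol S)) := by
    intro S e
    have h1 : pderiv (Sum.inl e) (rename Sum.inl (sqVol S) :
        MvPolynomial (Edge n ⊕ {S : Face n // S ∉ B}) ℂ) =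
        rename Sum.inl (pderiv e (sqVol S)) := pderiv_rename Sum.inl_injective _ _
    rw [fibreSystem]
    split_ifs with hS
    · rw [map_sub, pderiv_C, sub_zero, h1, eval_rename]
      rfl
    · rw [map_sub, pderiv_X_of_ne Sum.inr_ne_inl, sub_zero, h1, eval_rename]
      rfl
  have hr : ∀ S U, eval (Sum.elim t 0) (pderiv (Sum.inr U) (fibreSystem sqVol B b S)) =
      if S = U.1 then -1 else 0 := by
    intro S U
    have h1 : pderiv (Sum.inr U) (rename Sum.inl (sqVol S) :
        MvPolynomial (Edge n ⊕ {S : Face n // S ∉ B}) ℂ) = 0 := by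
      refine pderiv_eq_zero_of_notMem_vars fun hU => ?_
      obtain ⟨e, _, he⟩ := mem_vars_rename _ _ hU
      exact Sum.inl_ne_inr he
    rw [fibreSystem]
    split_ifs with hS hSU hSU
    · exact absurd (hSU ▸ hS) U.2
    · rw [map_sub, pderiv_C, h1, sub_zero, map_zero]
    · rw [map_sub, h1, zero_sub]
      subst hSU
      rw [pderiv_X_self, map_neg, map_one]
    · rw [map_sub, h1, zero_sub, pderiv_X_of_ne, neg_zero, map_zero]
      intro h
      exact hSU (congrArg Subtype.val (Sum.inr_injective h))
  rw [Fintype.linearIndependent_iff] at ht ⊢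
  intro g hg
  have hgB : ∀ S ∉ B, g S = 0 := by
    intro S hS
    have h1 := congrFun hg (Sum.inr ⟨S, hS⟩)
    simpa [Finset.sum_apply, hr] using h1
  have h2 := ht (fun S => g S.1) (by
    funext e
    have h3 := congrFun hg (Sum.inl e)
    simp only [Finset.sum_apply, Pi.smul_apply, hl] at h3 ⊢
    refine Eq.trans ?_ h3
    exact (sum_eq_sum_coe_of_eq_zero (f := fun S => g S • eval t (pderiv e (sqVol S)))
      fun S hS => by rw [hgB S hS, zero_smul]).symm)
  intro S
  by_cases hS : S ∈ B
  · exact h2 ⟨S, hS⟩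
  · exact hgB S hS

theorem eval_pderiv_toFace_heronEquation (t : Edge n → ℂ) (T : {S : Face n // 2 < S.1.card})
    (e : Edge n) : eval (volMap n t) (pderiv e.toFace (heronEquation T)) =
      -eval t (pderiv e (sqVol T.1)) := by
  have hne : T.1 ≠ e.toFace := by
    intro h
    have h1 := T.2
    have h2 : e.toFace.1.card = 2 := e.2
    rw [h] at h1
    omega
  rw [heronEquation, map_sub, pderiv_X_of_ne hne, zero_sub, pderiv_rename toFace_injective,
    map_neg, eval_rename]
  congr 3
  funext f
  simp [volMap, sqVol_toFace]

theorem eval_pderiv_heronEquation [DecidableEq (Face n)] (x : Face n → ℂ)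
    (T U : {S : Face n // 2 < S.1.card}) :
    eval x (pderiv U.1 (heronEquation T)) = if T = U then 1 else 0 := by
  have h1 : pderiv U.1 (rename Edge.toFace (sqVol T.1)) = 0 := by
    refine pderiv_eq_zero_of_notMem_vars fun hU => ?_
    obtain ⟨e, _, he⟩ := mem_vars_rename _ _ hU
    have h2 := U.2
    have h3 : e.toFace.1.card = 2 := e.2
    rw [← he] at h2
    omega
  rw [heronEquation, map_sub, h1, sub_zero]
  split_ifs with h
  · rw [h, pderiv_X_self, map_one]
  · rw [pderiv_X_of_ne fun h' => h (Subtype.ext h'), map_zero]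

/-- The gradients of the Heron equations with respect to the faces outside `B` are linearly
independent if the gradients of the squared volumes of the faces in `B` are. -/
theorem linearIndependent_heronEquation
    {t : Edge n → ℂ} (ht : LinearIndependent ℂ fun (S : B) e => eval t (pderiv e (sqVol S.1))) :
    LinearIndependent ℂ fun (T : {S : Face n // 2 < S.1.card}) (U : {S : Face n // S ∉ B}) =>
      eval (volMap n t) (pderiv U.1 (heronEquation T)) := by
  classical
  rw [Fintype.linearIndependent_iff] at ht ⊢
  intro c hc
  -- `G` is the full gradient of `∑ T, c T • f_T` at `volMap n t`. It vanishes off `B` by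
  -- assumption, and since each `f_T` vanishes on the image of `φ`, it is a relation among the
  -- gradients of the volumes.
  set G : Face n → ℂ := fun S => if h : 2 < S.1.card then c ⟨S, h⟩ else
    -∑ T, c T * eval t (pderiv ((edgeEquiv n).symm ⟨S, h⟩) (sqVol T.1)) with hG
  have hGT : ∀ T : {S : Face n // 2 < S.1.card}, G T.1 = c T := fun T => dif_pos T.2
  have hGe : ∀ e : Edge n, G e.toFace = -∑ T, c T * eval t (pderiv e (sqVol T.1)) := fun e =>
    dif_neg (edgeEquiv n e).2
  have hGB : ∀ S ∉ B, G S = 0 := by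
    intro S hS
    have h1 := congrFun hc ⟨S, hS⟩
    simp only [Finset.sum_apply, Pi.smul_apply, smul_eq_mul, Pi.zero_apply] at h1
    by_cases h2 : 2 < S.1.card
    · have h3 : ∀ T, eval (volMap n t) (pderiv S (heronEquation T)) =
          if T = ⟨S, h2⟩ then 1 else 0 := fun T =>
        eval_pderiv_heronEquation (volMap n t) T ⟨S, h2⟩
      simp only [h3, mul_ite, mul_one, mul_zero, sum_ite_eq', mem_univ, if_true] at h1
      exact (hGT ⟨S, h2⟩).trans h1
    · obtain ⟨e, rfl⟩ : ∃ e : Edge n, e.toFace = S := ⟨(edgeEquiv n).symm ⟨S, h2⟩, rfl⟩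
      simp only [eval_pderiv_toFace_heronEquation, mul_neg, sum_neg_distrib] at h1
      rw [hGe, h1]
  have h1 := ht (fun S => G S.1) (by
    funext e
    simp only [Finset.sum_apply, Pi.smul_apply, smul_eq_mul, Pi.zero_apply]
    rw [← sum_eq_sum_coe_of_eq_zero (B := B)
      (f := fun S => G S * eval t (pderiv e (sqVol S))) fun S hS => by rw [hGB S hS, zero_mul],
      sum_face]
    simp only [hGT, hGe, sqVol_toFace]
    rw [sum_eq_single e]
    · rw [pderiv_X_self, map_one, mul_one, add_neg_cancel]
    · intro f _ hf
      rw [pderiv_X_of_ne hf, map_zero, mul_zero]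
    · simp)
  intro T
  rw [← hGT T]
  by_cases hT : T.1 ∈ B
  · exact h1 ⟨T.1, hT⟩
  · exact hGB _ hT

theorem pderiv_implicitFibreSystem (b : B → ℂ) (T : {S : Face n // 2 < S.1.card})
    (U : {S : Face n // S ∉ B}) (y : {S : Face n // S ∉ B} → ℂ) :
    eval y (pderiv U (implicitFibreSystem B b T)) =
      eval (fun S => if h : S ∈ B then b ⟨S, h⟩ else y ⟨S, h⟩)
        (pderiv U.1 (heronEquation T)) := by
  classical
  rw [implicitFibreSystem, pderiv_aeval, sum_eq_single U.1]
  · rw [dif_neg U.2, pderiv_X_self, mul_one, ← eval_eval_eq_eval_aeval]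
    congr 2
    funext S
    split_ifs <;> simp
  · intro S _ hS
    split_ifs with h
    · rw [pderiv_C, mul_zero]
    · rw [pderiv_X_of_ne, mul_zero]
      intro h'
      exact hS (congrArg Subtype.val h')
  · simp

/-- Here the Jacobian does depend on `b`. With the coordinates outside `B` frozen at `volMap n t`,
its determinant is a polynomial in `b`, nonzero at the restriction of `volMap n t` to `B`; this
polynomial defines genericity. -/
theorem forGeneric_affineMixedVolume_implicitFibreSystem_ne_zero
    (hB : #B = Fintype.card (Edge n)) {t : Edge n → ℂ}
    (ht : LinearIndependent ℂ fun (S : B) e => eval t (pderiv e (sqVol S.1))) :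
    ForGeneric fun b : B → ℂ => affineMixedVolume (implicitFibreSystem B b) ≠ 0 := by
  classical
  have hc := card_implicitFibreSystem hB
  obtain ⟨e⟩ : Nonempty ({S : Face n // S ∉ B} ≃ {S : Face n // 2 < S.1.card}) :=
    ⟨(Fintype.equivOfCardEq hc).symm⟩
  set M : Matrix {S : Face n // S ∉ B} {S : Face n // S ∉ B} (MvPolynomial B ℂ) :=
    Matrix.of fun V U => aeval (fun S : Face n => if h : S ∈ B then
      (X ⟨S, h⟩ : MvPolynomial B ℂ) else C (volMap n t S)) (pderiv U.1 (heronEquation (e V)))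
    with hM
  have hMb : ∀ b : B → ℂ, (eval b).mapMatrix M = Matrix.of fun V U =>
      eval (fun S => if h : S ∈ B then b ⟨S, h⟩ else volMap n t S)
        (pderiv U.1 (heronEquation (e V))) := by
    intro b
    ext V U
    rw [RingHom.mapMatrix_apply, map_apply, hM, of_apply, of_apply, ← eval_eval_eq_eval_aeval]
    congr 2
    funext S
    split_ifs <;> simp
  refine ⟨M.det, fun h0 => ?_, fun b hb => ?_⟩
  · have h1 : ((eval fun S : B => volMap n t S).mapMatrix M).det = 0 := by
      rw [← RingHom.map_det, h0, map_zero]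
    have h2 : LinearIndependent ℂ ((eval fun S : B => volMap n t S).mapMatrix M).row := by
      rw [hMb]
      simp only [dite_eq_ite, ite_self]
      exact (linearIndependent_heronEquation ht).comp e e.injective
    rw [linearIndependent_rows_iff_isUnit, isUnit_iff_isUnit_det, h1] at h2
    exact not_isUnit_zero h2
  · refine affineMixedVolume_ne_zero_of_linearIndependent_gradient hc
      (x := fun S => volMap n t S.1) ?_
    rw [RingHom.map_det, hMb] at hb
    have h2 := (linearIndependent_rows_iff_isUnit.2
      ((isUnit_iff_isUnit_det _).2 (isUnit_iff_ne_zero.2 hb))).comp e.symm e.symm.injective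
    simp only [pderiv_implicitFibreSystem]
    have h3 : (Matrix.of fun V (U : {S : Face n // S ∉ B}) =>
        eval (fun S => if h : S ∈ B then b ⟨S, h⟩ else volMap n t S) (pderiv U.1 (heronEquation (e V)))).row ∘ e.symm =
        fun T (U : {S : Face n // S ∉ B}) =>
        eval (fun S => if h : S ∈ B then b ⟨S, h⟩ else volMap n t S)
          (pderiv U.1 (heronEquation T)) := by
      ext T U
      simp
    rw [h3] at h2
    exact h2

end Systems

/-! ### The tetrahedron -/

section Tetrahedron

/-- The Laplace expansion of a determinant along its first row, skipping zero entries. -/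
def laplaceDet : (k : ℕ) → (Fin k → Fin k → ℤ) → ℤ
  | 0, _ => 1
  | k + 1, M => (List.finRange (k + 1)).foldr (fun j s => if M 0 j = 0 then s else
      (-1) ^ (j : ℕ) * M 0 j * laplaceDet k (fun a b => M a.succ (j.succAbove b)) + s) 0

theorem laplaceDet_eq_det : ∀ (k : ℕ) (M : Fin k → Fin k → ℤ), laplaceDet k M = (Matrix.of M).det
  | 0, M => by simp [laplaceDet]
  | k + 1, M => by
    rw [det_succ_row_zero, laplaceDet, ← List.sum_ofFn, List.ofFn_eq_map, List.sum_eq_foldr,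
      List.foldr_map]
    congr 1
    funext j s
    split_ifs with h
    · simp [h]
    · rw [laplaceDet_eq_det]
      rfl

/-- The edges of the tetrahedron. -/
def tetEdge : Fin 6 → Edge 3 :=
  ![⟨{0, 1}, rfl⟩, ⟨{0, 2}, rfl⟩, ⟨{0, 3}, rfl⟩, ⟨{1, 2}, rfl⟩, ⟨{1, 3}, rfl⟩, ⟨{2, 3}, rfl⟩]

/-- The positive-dimensional faces of the tetrahedron. -/
def tetFace : Fin 11 → Face 3 :=
  ![⟨{0, 1}, by decide⟩, ⟨{0, 2}, by decide⟩, ⟨{0, 3}, by decide⟩, ⟨{1, 2}, by decide⟩,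
    ⟨{1, 3}, by decide⟩, ⟨{2, 3}, by decide⟩, ⟨{0, 1, 2}, by decide⟩, ⟨{0, 1, 3}, by decide⟩,
    ⟨{0, 2, 3}, by decide⟩, ⟨{1, 2, 3}, by decide⟩, ⟨{0, 1, 2, 3}, by decide⟩]

theorem tetEdge_injective : Function.Injective tetEdge := by decide

theorem card_edge_three : Fintype.card (Edge 3) = 6 := by decide +kernel

theorem tetEdge_bijective : Function.Bijective tetEdge :=
  (Fintype.bijective_iff_injective_and_card _).2 ⟨tetEdge_injective, card_edge_three.symm⟩

theorem tetFace_bijective : Function.Bijective tetFace :=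
  (Fintype.bijective_iff_injective_and_card _).2 ⟨by decide, by decide +kernel⟩

/-- The edges of the faces of the tetrahedron. -/
def tetEdgesOf : Fin 11 → Finset (Fin 6) :=
  ![{0}, {1}, {2}, {3}, {4}, {5}, {0, 1, 3}, {0, 2, 4}, {1, 2, 5}, {3, 4, 5}, {0, 1, 2, 3, 4, 5}]

theorem mem_tetEdgesOf_iff :
    ∀ S e, (tetEdge e).1 ⊆ (tetFace S).1 ↔ e ∈ tetEdgesOf S := by decide +kernel

/-- Multiples of the gradients of the squared volumes at one point. -/
def tetGradient : Fin 11 → Fin 6 → ℤ :=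
  ![![1, 0, 0, 0, 0, 0], ![0, 1, 0, 0, 0, 0], ![0, 0, 1, 0, 0, 0], ![0, 0, 0, 1, 0, 0],
    ![0, 0, 0, 0, 1, 0], ![0, 0, 0, 0, 0, 1], ![3, -1, 0, -1, 0, 0], ![-1, 0, 3, 0, -5, 0],
    ![0, -7, 1, 0, 0, 1], ![0, 0, 0, -3, -3, 5], ![-15, -17, 11, 11, -9, -7]]

/-- The sets of edges of a triangle, and the sets of all edges but one. -/
def tetEdgeSets : List (Finset (Fin 6)) :=
  [{0, 1, 3}, {0, 2, 4}, {1, 2, 5}, {3, 4, 5}, {1, 2, 3, 4, 5}, {0, 2, 3, 4, 5}, {0, 1, 3, 4, 5},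
    {0, 1, 2, 4, 5}, {0, 1, 2, 3, 5}, {0, 1, 2, 3, 4}]

/-- A finite check over the 462 six-element sets of faces, in integer arithmetic. A set `W` of three
edges needs its triangle and all three edges in `l`; one of five edges needs all six faces to avoid
the remaining edge. -/
theorem tet_dichotomy : ∀ l ∈ List.sublistsLen 6 (List.finRange 11),
    (∃ W ∈ tetEdgeSets, #W < (l.filter fun S => tetEdgesOf S ⊆ W).length) ∨
      laplaceDet 6 (fun a => tetGradient (l.getD a 0)) ≠ 0 := by
  decide +kernel

end Tetrahedron

/-! ### Explicit volume polynomials and their gradients at one point -/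

section TetrahedronGradients

theorem sqDist_eq_X {n : ℕ} {i j : Fin (n + 1)} (hij : i ≠ j) {e : Edge n} (he : e.1 = {i, j}) :
    sqDist i j = X e := by
  rw [sqDist, dif_neg hij]
  congr 1
  exact Subtype.ext he.symm

/-- Heron's formula in squared edge lengths. -/
theorem sqVol_of_eq_insert_insert {n : ℕ} {S : Face n} {i j k : Fin (n + 1)} (hij : i ≠ j)
    (hik : i ≠ k) (hjk : j ≠ k) (hS : S.1 = {i, j, k}) :
    sqVol S = C (1 / 16) * (2 * (sqDist i j * sqDist i k + sqDist i j * sqDist j k +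
      sqDist i k * sqDist j k) - sqDist i j ^ 2 - sqDist i k ^ 2 - sqDist j k ^ 2) := by
  have hc : S.1.card = 3 := by rw [hS]; exact card_eq_three.2 ⟨i, j, k, hij, hik, hjk, rfl⟩
  have hdet : (cayleyMenger S.1).det =
      -(2 * (sqDist i j * sqDist i k + sqDist i j * sqDist j k + sqDist i k * sqDist j k) -
        sqDist i j ^ 2 - sqDist i k ^ 2 - sqDist j k ^ 2) := by
    rw [det_cayleyMenger (g := ![i, j, k]) (S := S.1)
      (by intro a b; fin_cases a <;> fin_cases b <;>
            simp [hij, hik, hjk, hij.symm, hik.symm, hjk.symm])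
      (by
        rw [hS]
        ext x
        simp [Fin.exists_fin_succ, eq_comm])]
    simp [det_succ_row_zero, Fin.sum_univ_succ, sqDist_self, sqDist_comm j i, sqDist_comm k i,
      sqDist_comm k j, Fin.succAbove]
    ring
  have h1 : (1 / 16 : ℂ) = -((-1) ^ 3 / (((3 - 1).factorial : ℂ) ^ 2 * 2 ^ (3 - 1))) := by
    norm_num [Nat.factorial]
  rw [sqVol, hc, hdet, h1, C_neg]
  ring

/-- The classical volume formula: three terms for the pairs of opposite edges, minus one product for
each triangle. -/
theorem sqVol_tetFace_ten :
    sqVol (tetFace 10) = C (1 / 144) *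
      (X (tetEdge 0) * X (tetEdge 5) * (X (tetEdge 1) + X (tetEdge 2) + X (tetEdge 3) +
          X (tetEdge 4) - X (tetEdge 0) - X (tetEdge 5)) +
        X (tetEdge 1) * X (tetEdge 4) * (X (tetEdge 0) + X (tetEdge 2) + X (tetEdge 3) +
          X (tetEdge 5) - X (tetEdge 1) - X (tetEdge 4)) +
        X (tetEdge 2) * X (tetEdge 3) * (X (tetEdge 0) + X (tetEdge 1) + X (tetEdge 4) +
          X (tetEdge 5) - X (tetEdge 2) - X (tetEdge 3)) -
        X (tetEdge 0) * X (tetEdge 1) * X (tetEdge 3) -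
        X (tetEdge 0) * X (tetEdge 2) * X (tetEdge 4) -
        X (tetEdge 1) * X (tetEdge 2) * X (tetEdge 5) -
        X (tetEdge 3) * X (tetEdge 4) * X (tetEdge 5)) := by
  have h01 : sqDist (0 : Fin 4) 1 = X (tetEdge 0) := sqDist_eq_X (by decide) rfl
  have h02 : sqDist (0 : Fin 4) 2 = X (tetEdge 1) := sqDist_eq_X (by decide) rfl
  have h03 : sqDist (0 : Fin 4) 3 = X (tetEdge 2) := sqDist_eq_X (by decide) rfl
  have h12 : sqDist (1 : Fin 4) 2 = X (tetEdge 3) := sqDist_eq_X (by decide) rfl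
  have h13 : sqDist (1 : Fin 4) 3 = X (tetEdge 4) := sqDist_eq_X (by decide) rfl
  have h23 : sqDist (2 : Fin 4) 3 = X (tetEdge 5) := sqDist_eq_X (by decide) rfl
  have hc : (tetFace 10).1.card = 4 := by decide
  have hdet : (cayleyMenger (tetFace 10).1).det = 2 *
      (X (tetEdge 0) * X (tetEdge 5) * (X (tetEdge 1) + X (tetEdge 2) + X (tetEdge 3) +
          X (tetEdge 4) - X (tetEdge 0) - X (tetEdge 5)) +
        X (tetEdge 1) * X (tetEdge 4) * (X (tetEdge 0) + X (tetEdge 2) + X (tetEdge 3) +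
          X (tetEdge 5) - X (tetEdge 1) - X (tetEdge 4)) +
        X (tetEdge 2) * X (tetEdge 3) * (X (tetEdge 0) + X (tetEdge 1) + X (tetEdge 4) +
          X (tetEdge 5) - X (tetEdge 2) - X (tetEdge 3)) -
        X (tetEdge 0) * X (tetEdge 1) * X (tetEdge 3) -
        X (tetEdge 0) * X (tetEdge 2) * X (tetEdge 4) -
        X (tetEdge 1) * X (tetEdge 2) * X (tetEdge 5) -
        X (tetEdge 3) * X (tetEdge 4) * X (tetEdge 5)) := by
    rw [det_cayleyMenger (g := id) (S := (tetFace 10).1) Function.injective_id (by decide)]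
    have hM : Matrix.of (vecCons (vecCons (0 : MvPolynomial (Edge 3) ℂ) fun _ => 1)
        fun i : Fin 4 => vecCons 1 fun j : Fin 4 => sqDist (id i) (id j)) =
        !![0, 1, 1, 1, 1;
          1, 0, X (tetEdge 0), X (tetEdge 1), X (tetEdge 2);
          1, X (tetEdge 0), 0, X (tetEdge 3), X (tetEdge 4);
          1, X (tetEdge 1), X (tetEdge 3), 0, X (tetEdge 5);
          1, X (tetEdge 2), X (tetEdge 4), X (tetEdge 5), 0] := by
      rw [← h01, ← h02, ← h03, ← h12, ← h13, ← h23]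
      ext1 a b
      refine Fin.cases ?_ (fun i => ?_) a <;> refine Fin.cases ?_ (fun j => ?_) b
      · rfl
      · fin_cases j <;> rfl
      · fin_cases i <;> rfl
      · fin_cases i <;> fin_cases j <;>
          first | rfl | exact sqDist_self _ | exact sqDist_comm 1 0 | exact sqDist_comm 2 0 |
            exact sqDist_comm 2 1 | exact sqDist_comm 3 0 | exact sqDist_comm 3 1 |
            exact sqDist_comm 3 2
    rw [hM]
    generalize (X (tetEdge 0) : MvPolynomial (Edge 3) ℂ) = a
    generalize (X (tetEdge 1) : MvPolynomial (Edge 3) ℂ) = b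
    generalize (X (tetEdge 2) : MvPolynomial (Edge 3) ℂ) = c
    generalize (X (tetEdge 3) : MvPolynomial (Edge 3) ℂ) = d
    generalize (X (tetEdge 4) : MvPolynomial (Edge 3) ℂ) = e
    generalize (X (tetEdge 5) : MvPolynomial (Edge 3) ℂ) = f
    simp [det_succ_row_zero, Fin.sum_univ_succ, Fin.succAbove]
    ring
  have h1 : (1 / 144 : ℂ) = ((-1) ^ 4 / (((4 - 1).factorial : ℂ) ^ 2 * 2 ^ (4 - 1))) * 2 := by
    norm_num [Nat.factorial]
  have h2 : (2 : MvPolynomial (Edge 3) ℂ) = C 2 := rfl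
  rw [sqVol, hc, hdet, h1, C_mul, h2, ← mul_assoc (C _) (C 2)]

/-- The squared edge lengths at which the gradients are evaluated. -/
noncomputable def tetPoint (e : Edge 3) : ℂ :=
  (![1, -1, 3, -1, -1, 3] : Fin 6 → ℂ) ((Equiv.ofBijective tetEdge tetEdge_bijective).symm e)

theorem tetPoint_tetEdge (i : Fin 6) :
    tetPoint (tetEdge i) = (![1, -1, 3, -1, -1, 3] : Fin 6 → ℂ) i :=
  congrArg _ ((Equiv.ofBijective tetEdge tetEdge_bijective).symm_apply_apply i)

theorem pderiv_X_tetEdge (i j : Fin 6) :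
    pderiv (tetEdge i) (X (tetEdge j) : MvPolynomial (Edge 3) ℂ) = if i = j then 1 else 0 := by
  split_ifs with h
  · rw [h, pderiv_X_self]
  · exact pderiv_X_of_ne fun h' => h (tetEdge_injective h').symm

theorem sqVol_tetFace_edge (S : Fin 6) :
    sqVol (tetFace (S.castLE (by norm_num))) = X (tetEdge S) := by
  rw [← sqVol_toFace]
  congr 1
  fin_cases S <;> rfl

theorem eval_pderiv_triangle (a b c : Fin 6) (e : Fin 6) :
    eval tetPoint (pderiv (tetEdge e) (C (1 / 16) * (2 * (X (tetEdge a) * X (tetEdge b) +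
      X (tetEdge a) * X (tetEdge c) + X (tetEdge b) * X (tetEdge c)) - X (tetEdge a) ^ 2 -
      X (tetEdge b) ^ 2 - X (tetEdge c) ^ 2))) =
    -1 / 8 * (
      (if e = a then 1 else 0) * (tetPoint (tetEdge a) - tetPoint (tetEdge b) -
        tetPoint (tetEdge c)) +
      (if e = b then 1 else 0) * (tetPoint (tetEdge b) - tetPoint (tetEdge a) -
        tetPoint (tetEdge c)) +
      (if e = c then 1 else 0) * (tetPoint (tetEdge c) - tetPoint (tetEdge a) -
        tetPoint (tetEdge b))) := by
  have h2 : (2 : MvPolynomial (Edge 3) ℂ) = C 2 := rfl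
  simp only [h2, pderiv_C, map_sub, map_add, pderiv_mul, pderiv_pow, pderiv_X_tetEdge,
    map_mul, eval_C, eval_X, map_pow, apply_ite (eval tetPoint), map_one, map_zero,
    pow_one, Nat.cast_ofNat, Nat.add_one_sub_one]
  ring

/-- The factors `1`, `-1 / 8` and `1 / 144` clear denominators, so that independence can be tested
on integer rows; nonzero row scalings do not affect it. -/
theorem exists_eval_pderiv_sqVol_tetFace (S : Fin 11) : ∃ c : ℂ, c ≠ 0 ∧ ∀ e : Fin 6,
    eval tetPoint (pderiv (tetEdge e) (sqVol (tetFace S))) = c * tetGradient S e := by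
  have hedge : ∀ S : Fin 6, ∃ c : ℂ, c ≠ 0 ∧ ∀ e : Fin 6,
      eval tetPoint (pderiv (tetEdge e) (sqVol (tetFace (S.castLE (by norm_num))))) =
        c * tetGradient (S.castLE (by norm_num)) e := by
    intro S
    refine ⟨1, one_ne_zero, fun e => ?_⟩
    rw [sqVol_tetFace_edge, pderiv_X_tetEdge, apply_ite (eval tetPoint), map_one, map_zero]
    fin_cases S <;> fin_cases e <;> simp [tetGradient]
  have htri : ∀ (S : Fin 11) (i j k : Fin 4) (a b c : Fin 6), i ≠ j → i ≠ k → j ≠ k →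
      (tetFace S).1 = {i, j, k} → (tetEdge a).1 = {i, j} → (tetEdge b).1 = {i, k} →
      (tetEdge c).1 = {j, k} → ∀ e : Fin 6,
      eval tetPoint (pderiv (tetEdge e) (sqVol (tetFace S))) = -1 / 8 * (
      (if e = a then 1 else 0) * (tetPoint (tetEdge a) - tetPoint (tetEdge b) -
        tetPoint (tetEdge c)) +
      (if e = b then 1 else 0) * (tetPoint (tetEdge b) - tetPoint (tetEdge a) -
        tetPoint (tetEdge c)) +
      (if e = c then 1 else 0) * (tetPoint (tetEdge c) - tetPoint (tetEdge a) -
        tetPoint (tetEdge b))) := by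
    intro S i j k a b c hij hik hjk hS ha hb hc e
    rw [sqVol_of_eq_insert_insert hij hik hjk hS, sqDist_eq_X hij ha, sqDist_eq_X hik hb,
      sqDist_eq_X hjk hc, eval_pderiv_triangle]
  have h8 : (-1 / 8 : ℂ) ≠ 0 := by norm_num
  fin_cases S
  · exact hedge 0
  · exact hedge 1
  · exact hedge 2
  · exact hedge 3
  · exact hedge 4
  · exact hedge 5
  · refine ⟨-1 / 8, h8, fun e => (htri 6 0 1 2 0 1 3 (by decide) (by decide) (by decide) rfl rfl
      rfl rfl e).trans ?_⟩
    congr 1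
    fin_cases e <;> simp [tetPoint_tetEdge, tetGradient] <;> norm_num
  · refine ⟨-1 / 8, h8, fun e => (htri 7 0 1 3 0 2 4 (by decide) (by decide) (by decide) rfl rfl
      rfl rfl e).trans ?_⟩
    congr 1
    fin_cases e <;> simp [tetPoint_tetEdge, tetGradient] <;> norm_num
  · refine ⟨-1 / 8, h8, fun e => (htri 8 0 2 3 1 2 5 (by decide) (by decide) (by decide) rfl rfl
      rfl rfl e).trans ?_⟩
    congr 1
    fin_cases e <;> simp [tetPoint_tetEdge, tetGradient] <;> norm_num
  · refine ⟨-1 / 8, h8, fun e => (htri 9 1 2 3 3 4 5 (by decide) (by decide) (by decide) rfl rfl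
      rfl rfl e).trans ?_⟩
    congr 1
    fin_cases e <;> simp [tetPoint_tetEdge, tetGradient] <;> norm_num
  · refine ⟨1 / 144, by norm_num, fun e => ?_⟩
    change eval tetPoint (pderiv (tetEdge e) (sqVol (tetFace 10))) = _
    rw [sqVol_tetFace_ten, pderiv_C_mul, map_mul, eval_C]
    congr 1
    simp only [map_sub, map_add, pderiv_mul, pderiv_X_tetEdge, map_mul, eval_X,
      apply_ite (eval tetPoint), map_one, map_zero, tetPoint_tetEdge]
    fin_cases e <;> simp [tetGradient] <;> norm_num

end TetrahedronGradients

/-- Six faces of the tetrahedron either include too many faces within a set of edges, or have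
linearly independent gradients. -/
theorem lt_facesWithin_or_linearIndependent {B : Finset (Face 3)} (hB : #B = 6) :
    (∃ W, #W < #(facesWithin B W)) ∨
      LinearIndependent ℂ fun (S : B) e => eval tetPoint (pderiv e (sqVol S.1)) := by
  -- Listing `B` in increasing order of index makes it one of the sublists covered by
  -- `tet_dichotomy`.
  set l : List (Fin 11) := (List.finRange 11).filter fun s => tetFace s ∈ B with hl
  have hmem : ∀ s, s ∈ l ↔ tetFace s ∈ B := by
    intro s
    simp [hl]
  have hnd : l.Nodup := (List.nodup_finRange 11).filter _
  have hlB : l.toFinset.map ⟨tetFace, tetFace_bijective.1⟩ = B := by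
    ext S
    obtain ⟨s, rfl⟩ := tetFace_bijective.2 S
    rw [mem_map]
    constructor
    · rintro ⟨s', hs', h⟩
      rw [← h]
      exact (hmem s').1 (List.mem_toFinset.1 hs')
    · intro h
      exact ⟨s, List.mem_toFinset.2 ((hmem s).2 h), rfl⟩
  have hlen : l.length = 6 := by
    rw [← hB, ← hlB, card_map, List.toFinset_card_of_nodup hnd]
  rcases tet_dichotomy l (List.mem_sublistsLen.2 ⟨List.filter_sublist, hlen⟩) with
    ⟨W, -, hW⟩ | hdet
  · refine Or.inl ⟨W.map ⟨tetEdge, tetEdge_injective⟩, ?_⟩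
    rw [card_map]
    refine hW.trans_le ?_
    rw [← List.toFinset_card_of_nodup (hnd.filter _),
      ← card_map ⟨tetFace, tetFace_bijective.1⟩]
    refine card_le_card fun S hS => ?_
    obtain ⟨s, hs, rfl⟩ := mem_map.1 hS
    rw [List.mem_toFinset, List.mem_filter] at hs
    refine mem_filter.2 ⟨(hmem s).1 hs.1, fun e he => ?_⟩
    obtain ⟨i, rfl⟩ := tetEdge_bijective.2 e
    exact mem_map_of_mem _ ((of_decide_eq_true hs.2) ((mem_tetEdgesOf_iff s i).1 he))
  · right
    -- The list has length six, so the default value of `getD` is never reached.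
    have hget : ∀ a : Fin 6, l.getD a 0 = l[(a : ℕ)]'(by rw [hlen]; exact a.2) := fun a =>
      List.getD_eq_getElem _ _ _
    set g : Fin 6 → B := fun a => ⟨tetFace (l.getD a 0), (hmem _).1 (by
      rw [hget]
      exact List.getElem_mem _)⟩ with hg
    have hgi : Function.Injective g := by
      intro a b hab
      have h1 : l.getD a 0 = l.getD b 0 := tetFace_bijective.1 (congrArg (fun S : B => S.1) hab)
      rw [hget, hget] at h1
      exact Fin.ext ((hnd.getElem_inj_iff).1 h1)
    have hgb : Function.Bijective g :=
      (Fintype.bijective_iff_injective_and_card _).2 ⟨hgi, by simp [hB]⟩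
    rw [← linearIndependent_equiv (Equiv.ofBijective g hgb), Fintype.linearIndependent_iff]
    intro c hc a
    choose k hk0 hk using exists_eval_pderiv_sqVol_tetFace
    set M : Matrix (Fin 6) (Fin 6) ℤ := Matrix.of fun a => tetGradient (l.getD a 0) with hM
    have hMdet : ((Int.castRingHom ℂ).mapMatrix M).det ≠ 0 := by
      rw [← RingHom.map_det, hM, ← laplaceDet_eq_det]
      exact Int.cast_ne_zero.2 hdet
    -- The row scalings are absorbed into the coefficients of the relation.
    have h0 : (fun a => c a * k (l.getD a 0)) ᵥ* (Int.castRingHom ℂ).mapMatrix M = 0 := by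
      funext i
      have h1 := congrFun hc (tetEdge i)
      simp only [Finset.sum_apply, Pi.smul_apply, Function.comp_apply, smul_eq_mul,
        Equiv.ofBijective_apply, hg, hk, Pi.zero_apply] at h1
      rw [Pi.zero_apply, ← h1]
      change ∑ a, c a * k (l.getD a 0) * (tetGradient (l.getD a 0) i : ℂ) = _
      exact sum_congr rfl fun a _ => mul_assoc _ _ _
    have h1 : (fun a => c a * k (l.getD a 0)) = 0 := by
      by_contra hne
      exact hMdet (exists_vecMul_eq_zero_iff.1 ⟨_, hne, h0⟩)
    exact (mul_eq_zero.1 (congrFun h1 a)).resolve_right (hk0 _)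

/-! ### The BKK test and the final assembly -/

theorem isBasisBKK_eq_some_false_iff {ι ρ : Type*} [Fintype ι] [DecidableEq ι] [Fintype ρ]
    (φ : ι → MvPolynomial ρ ℂ) (B : Finset ι) (b : B → ℂ) :
    isBasisBKK φ B b = some false ↔ affineMixedVolume (fibreSystem φ B b) = 0 := by
  unfold isBasisBKK
  split_ifs with h <;> simp [h]

theorem isBasisBKK_eq_none_iff {ι ρ : Type*} [Fintype ι] [DecidableEq ι] [Fintype ρ]
    (φ : ι → MvPolynomial ρ ℂ) (B : Finset ι) (b : B → ℂ) :
    isBasisBKK φ B b = none ↔ affineMixedVolume (fibreSystem φ B b) ≠ 0 := by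
  unfold isBasisBKK
  split_ifs with h <;> simp [h]

end Heron

theorem mainTheorem3 (B : Finset (Heron.Face 3)) (hB : B.card = 6) :
    Heron.ForGeneric fun b : B → ℂ =>
      (¬ Heron.IsAlgebraicBasis (Heron.heronVariety 3) B ↔
        Heron.affineMixedVolume (Heron.fibreSystem (Heron.sqVol (n := 3)) B b) = 0) ∧
      (¬ Heron.IsAlgebraicBasis (Heron.heronVariety 3) B ↔
        Heron.affineMixedVolume (Heron.implicitFibreSystem B b) = 0) ∧
      (Heron.isBasisBKK (Heron.sqVol (n := 3)) B b = some false ↔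
        ¬ Heron.IsAlgebraicBasis (Heron.heronVariety 3) B) ∧
      (Heron.isBasisBKK (Heron.sqVol (n := 3)) B b = none ↔
        Heron.IsAlgebraicBasis (Heron.heronVariety 3) B) := by
  have hc : B.card = Fintype.card (Heron.Edge 3) := hB.trans Heron.card_edge_three.symm
  simp only [Heron.isBasisBKK_eq_some_false_iff, Heron.isBasisBKK_eq_none_iff]
  rw [Heron.isAlgebraicBasis_heronVariety_iff hc]
  rcases Heron.lt_facesWithin_or_linearIndependent hB with ⟨W, hW⟩ | hli
  · have h1 := Heron.not_algebraicIndependent_of_lt_facesWithin hW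
    -- The obstruction does not depend on `b`, so every `b` is generic.
    refine ⟨1, one_ne_zero, fun b _ => ?_⟩
    have h2 := Heron.affineMixedVolume_fibreSystem_eq_zero hc hW b
    have h3 := Heron.affineMixedVolume_implicitFibreSystem_eq_zero hc hW b
    exact ⟨iff_of_true h1 h2, iff_of_true h1 h3, iff_of_true h2 h1,
      iff_of_false (fun h => h h2) h1⟩
  · have h1 := Heron.algebraicIndependent_of_linearIndependent_gradient
      ((Fintype.card_coe B).trans hc) hli
    obtain ⟨g, hg, hgb⟩ :=
      Heron.forGeneric_affineMixedVolume_implicitFibreSystem_ne_zero hc hli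
    -- Only the implicit system constrains `b`.
    refine ⟨g, hg, fun b hb => ?_⟩
    have h2 := Heron.affineMixedVolume_fibreSystem_ne_zero hc hli b
    have h3 := hgb b hb
    exact ⟨iff_of_false (fun h => h h1) h2, iff_of_false (fun h => h h1) h3,
      iff_of_false h2 (fun h => h h1), iff_of_true h2 h1⟩
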